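/- Let $0<q<1$. For $1\le m\le n$ the Meixner ensemble $M(m,n)$ is the probability measure on $\mathbb{N}^m$, $\mathbb{N}=\{0,1,2,\dots\}$, given by $$(h_1,\dots,h_m)\mapsto Z_{m,n}^{-1}\prod_{1\le i<j\le m}(h_i-h_j)^2\prod_{i=1}^{m}\binom{h_i+n-m}{h_i}q^{h_i},$$ where $Z_{m,n}$ is the normalizing constant, and $\lambda^*(M_{m,n})=\max_i h_i$ denotes its rightmost particle. For two random variables $X,Y$ with values in $\mathbb{N}$ (not necessarily on the same probability space) write $X\prec Y$ if $\mathbf P(X\in A)\le \mathbf P(Y\in A)$ for every increasing set $A\subseteq\mathbb{N}$. Then, for every $n\ge 2$: 1. $\lambda^*(M_{n-1,n+1})\prec\lambda^*(M_{n,n})$. 2. Let $w(i,j)$, $(i,j)\in\mathbb{N}^2$, be i.i.d. geometric random variables with parameter $q$, that is, $\mathbf P(w(i,j)=k)=(1-q)q^k$ for $k=0,1,2,\dots$, and for $m,n\ge1$ let $$G(m,n)=\max_{\pi}\sum_{(i,j)\in\pi}w(i,j),$$ where the maximum is over all up-right lattice paths $\pi$ from $(1,1)$ to $(m,n)$ (each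 step increases exactly one coordinate by $1$). Then $G(n-1,n+1)\prec G(n,n)$. -/

import Mathlib

open MeasureTheory ProbabilityTheory
open scoped ENNReal

/-- The law `μ` is stochastically dominated by the law `ν`: every measurable increasing set has
at least as much mass under `ν` as under `μ`. -/
def StochDom {α : Type*} [Preorder α] [MeasurableSpace α] (μ ν : Measure α) : Prop :=
  ∀ A : Set α, MeasurableSet A → IsUpperSet A → μ A ≤ ν A

/-! ### The Meixner ensemble -/

/-- The unnormalised weight of the configuration `h = (h₁, …, hₘ) ∈ ℕᵐ` in the Meixner ensemble
`M(m, n)`, `m ≤ n`: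
`∏_{i < j} (hᵢ - hⱼ)² * ∏ᵢ binom(hᵢ + n - m, hᵢ) q ^ hᵢ`. -/
noncomputable def meixnerWeight (q : ℝ) (m n : ℕ) (h : Fin m → ℕ) : ℝ :=
  (∏ i : Fin m, ∏ j ∈ Finset.Ioi i, ((h i : ℝ) - (h j : ℝ)) ^ 2) *
    ∏ i : Fin m, (((h i + (n - m)).choose (h i) : ℕ) : ℝ) * q ^ h i

theorem meixner_tsum_ne_zero {q : ℝ} (hq0 : 0 < q) (m n : ℕ) :
    ∑' h : Fin m → ℕ, ENNReal.ofReal (meixnerWeight q m n h) ≠ 0 := by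
  intro H
  rw [ENNReal.tsum_eq_zero] at H
  have h1 := H (fun i => (i : ℕ))
  rw [ENNReal.ofReal_eq_zero] at h1
  have h2 : 0 < meixnerWeight q m n (fun i => (i : ℕ)) := by
    unfold meixnerWeight
    refine mul_pos (Finset.prod_pos fun i _ => Finset.prod_pos fun j hj => ?_)
      (Finset.prod_pos fun i _ => mul_pos ?_ (pow_pos hq0 _))
    · have h3 : i < j := Finset.mem_Ioi.mp hj
      have h4 : ((i : ℕ) : ℝ) < ((j : ℕ) : ℝ) := by exact_mod_cast h3
      exact sq_pos_of_ne_zero (sub_ne_zero.2 h4.ne)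
    · exact_mod_cast Nat.choose_pos (Nat.le_add_right _ _)
  linarith

theorem ennreal_tsum_pi_ne_top (f : ℕ → ℝ≥0∞) (hf : ∑' k, f k ≠ ∞) (m : ℕ) :
    ∑' h : Fin m → ℕ, ∏ i, f (h i) ≠ ∞ := by
  induction m with
  | zero => simp
  | succ m ih =>
    have e : ∑' h : Fin (m + 1) → ℕ, ∏ i, f (h i)
        = ∑' p : ℕ × (Fin m → ℕ), f p.1 * ∏ i, f (p.2 i) := by
      rw [← (Fin.consEquiv (fun _ : Fin (m + 1) => ℕ)).tsum_eq]
      refine tsum_congr fun p => ?_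
      rw [Fin.prod_univ_succ]
      simp [Fin.consEquiv]
    rw [e, ENNReal.tsum_prod']
    simp only [ENNReal.tsum_mul_left, ENNReal.tsum_mul_right]
    exact ENNReal.mul_ne_top hf ih

theorem meixner_tsum_ne_top {q : ℝ} (hq0 : 0 < q) (hq1 : q < 1) (m n : ℕ) :
    ∑' h : Fin m → ℕ, ENNReal.ofReal (meixnerWeight q m n h) ≠ ∞ := by
  set k := n - m with hk
  let g : ℕ → ℝ := fun x => ((1 + x : ℝ) ^ 2) ^ (2 * m) * ((x + k : ℝ) ^ k) * q ^ x
  have g0 : ∀ x, 0 ≤ g x := fun x => by positivity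
  have hle : ∀ h : Fin m → ℕ, meixnerWeight q m n h ≤ ∏ i, g (h i) := by
    intro h
    have hone : ∀ i : Fin m, (1 : ℝ) ≤ (1 + h i : ℝ) ^ 2 := fun i => by
      have : (0 : ℝ) ≤ (h i : ℝ) := by positivity
      nlinarith
    have hV : (∏ i : Fin m, ∏ j ∈ Finset.Ioi i, ((h i : ℝ) - (h j : ℝ)) ^ 2)
        ≤ ∏ i : Fin m, ((1 + h i : ℝ) ^ 2) ^ (2 * m) := by
      calc (∏ i : Fin m, ∏ j ∈ Finset.Ioi i, ((h i : ℝ) - (h j : ℝ)) ^ 2)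
          ≤ ∏ i : Fin m, ∏ j ∈ Finset.Ioi i, ((1 + h i : ℝ) ^ 2 * (1 + h j : ℝ) ^ 2) := by
            refine Finset.prod_le_prod (fun i _ => Finset.prod_nonneg fun j _ => sq_nonneg _)
              fun i _ => Finset.prod_le_prod (fun j _ => sq_nonneg _) fun j _ => ?_
            have ha : (0 : ℝ) ≤ (h i : ℝ) := by positivity
            have hb : (0 : ℝ) ≤ (h j : ℝ) := by positivity
            rw [← mul_pow]
            refine sq_le_sq' ?_ ?_ <;> nlinarith [mul_nonneg ha hb]
        _ ≤ ∏ i : Fin m, ∏ j : Fin m, ((1 + h i : ℝ) ^ 2 * (1 + h j : ℝ) ^ 2) := by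
            refine Finset.prod_le_prod (fun i _ => Finset.prod_nonneg fun j _ => by positivity)
              fun i _ => ?_
            exact Finset.prod_le_prod_of_subset_of_one_le (Finset.subset_univ _)
              (fun j _ => by positivity)
              (fun j _ _ => one_le_mul_of_one_le_of_one_le (hone i) (hone j))
        _ = ∏ i : Fin m, ((1 + h i : ℝ) ^ 2) ^ (2 * m) := by
            simp only [Finset.prod_mul_distrib, Finset.prod_const, Finset.card_univ,
              Fintype.card_fin, Finset.prod_pow]
            ring
    have hB : (∏ i : Fin m, (((h i + (n - m)).choose (h i) : ℕ) : ℝ) * q ^ h i)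
        ≤ ∏ i : Fin m, ((h i + k : ℝ) ^ k) * q ^ h i := by
      refine Finset.prod_le_prod (fun i _ => by positivity) fun i _ => ?_
      refine mul_le_mul_of_nonneg_right ?_ (by positivity)
      rw [← hk, Nat.choose_symm_add]
      exact_mod_cast Nat.choose_le_pow (h i + k) k
    calc meixnerWeight q m n h
        ≤ (∏ i : Fin m, ((1 + h i : ℝ) ^ 2) ^ (2 * m)) *
            ∏ i : Fin m, ((h i + k : ℝ) ^ k) * q ^ h i := by
          refine mul_le_mul hV hB (Finset.prod_nonneg fun i _ => by positivity)
            (Finset.prod_nonneg fun i _ => by positivity)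
      _ = ∏ i, g (h i) := by
          rw [← Finset.prod_mul_distrib]
          exact Finset.prod_congr rfl fun i _ => by simp only [g]; ring
  have hgle : ∀ x : ℕ, g x ≤ (((k : ℝ) + 1) ^ k) * (((x + 1 : ℕ) : ℝ) ^ (4 * m + k) * q ^ x) := by
    intro x
    have hx : (0 : ℝ) ≤ x := by positivity
    have hk0 : (0 : ℝ) ≤ k := by positivity
    have h1 : ((x : ℝ) + k) ^ k ≤ (((k : ℝ) + 1) * (x + 1)) ^ k :=
      pow_le_pow_left₀ (by positivity) (by nlinarith [mul_nonneg hk0 hx]) k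
    calc g x ≤ ((1 + x : ℝ) ^ 2) ^ (2 * m) * (((k : ℝ) + 1) * (x + 1)) ^ k * q ^ x := by
          simp only [g]; gcongr
      _ = _ := by push_cast; rw [mul_pow, ← pow_mul]; ring
  have hs : Summable g := by
    refine Summable.of_nonneg_of_le g0 hgle (Summable.mul_left _ ?_)
    have h0 : Summable fun x : ℕ => (x : ℝ) ^ (4 * m + k) * q ^ x :=
      summable_pow_mul_geometric_of_norm_lt_one _ (by rwa [Real.norm_of_nonneg hq0.le])
    have h1 := ((summable_nat_add_iff 1).2 h0).mul_left q⁻¹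
    refine h1.congr fun x => ?_
    rw [pow_succ]
    field_simp
  refine ne_top_of_le_ne_top
    (ennreal_tsum_pi_ne_top (fun x => ENNReal.ofReal (g x)) hs.tsum_ofReal_ne_top m) ?_
  refine ENNReal.tsum_le_tsum fun h => ?_
  rw [← ENNReal.ofReal_prod_of_nonneg fun i _ => g0 _]
  exact ENNReal.ofReal_le_ofReal (hle h)

/-- The Meixner ensemble `M(m, n)`, `m ≤ n`, with parameter `0 < q < 1`: the probability measure
on `ℕᵐ` proportional to `meixnerWeight`. -/
noncomputable def meixnerEnsemble (q : ℝ) (hq0 : 0 < q) (hq1 : q < 1) (m n : ℕ) :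
    PMF (Fin m → ℕ) :=
  PMF.normalize (fun h => ENNReal.ofReal (meixnerWeight q m n h))
    (meixner_tsum_ne_zero hq0 m n) (meixner_tsum_ne_top hq0 hq1 m n)

/-- The position of the rightmost particle of a configuration of `m ≥ 1` particles. -/
def rightmost {m : ℕ} (h : Fin m → ℕ) : ℕ := Finset.univ.sup h

/-- The law of the rightmost particle `λ*(M(m, n))` of the Meixner ensemble, `1 ≤ m ≤ n`. -/
noncomputable def meixnerRightmostLaw (q : ℝ) (hq0 : 0 < q) (hq1 : q < 1) (m n : ℕ) : Measure ℕ :=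
  (meixnerEnsemble q hq0 hq1 m n).toMeasure.map rightmost

/-! ### Directed last passage percolation -/

/-- An elementary up-right step in `ℕ²`. -/
def UpRightStep (a b : ℕ × ℕ) : Prop :=
  b = (a.1 + 1, a.2) ∨ b = (a.1, a.2 + 1)

/-- `π` is (the list of vertices of) an up-right path from `(1, 1)` to `(m, n)`. -/
def IsUpRightPath (m n : ℕ) (π : List (ℕ × ℕ)) : Prop :=
  π.head? = some (1, 1) ∧ π.getLast? = some (m, n) ∧ π.IsChain UpRightStep

/-- The last passage time `G(m, n)`, `m, n ≥ 1`: the maximal weight of an up-right path from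
`(1, 1)` to `(m, n)`, where `w (i, j)` is the weight of the vertex `(i, j)`. -/
noncomputable def lastPassage {Ω : Type*} (w : ℕ × ℕ → Ω → ℕ) (m n : ℕ) (ω : Ω) : ℕ :=
  sSup {s : ℕ | ∃ π : List (ℕ × ℕ), IsUpRightPath m n π ∧ s = (π.map fun v => w v ω).sum}

/-- The geometric law with parameter `q`, that is `P(w = k) = (1 - q) q ^ k` for `k = 0, 1, 2, …`
(success probability `1 - q`). -/
noncomputable def geometricLaw (q : ℝ) (hq0 : 0 < q) (hq1 : q < 1) : Measure ℕ :=
  geometricMeasure ⟨1 - q, by linarith, by linarith⟩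

open scoped NNReal FinsetFamily

/-! ### Finitely supported sequences and interlacing -/

noncomputable instance Finsupp.instDistribLatticeNat : DistribLattice (ℕ →₀ ℕ) :=
  { (inferInstance : Lattice (ℕ →₀ ℕ)) with
    le_sup_inf := fun x y z i => by
      simp only [Finsupp.inf_apply, Finsupp.sup_apply]
      exact le_sup_inf }

/-- `Interlaces a b` says that the sequences `a ≺ b` interlace:
`b 0 ≥ a 0 ≥ b 1 ≥ a 1 ≥ ⋯`. -/
def Interlaces (a b : ℕ →₀ ℕ) : Prop := ∀ i, b (i + 1) ≤ a i ∧ a i ≤ b i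

namespace Interlaces

variable {a b c d : ℕ →₀ ℕ}

theorem le (h : Interlaces a b) : a ≤ b := fun i => (h i).2

theorem inf (h : Interlaces a b) (h' : Interlaces c d) : Interlaces (a ⊓ c) (b ⊓ d) := fun i => by
  have := h i; have := h' i
  simp only [Finsupp.inf_apply]; omega

theorem sup (h : Interlaces a b) (h' : Interlaces c d) : Interlaces (a ⊔ c) (b ⊔ d) := fun i => by
  have := h i; have := h' i
  simp only [Finsupp.sup_apply]; omega

end Interlaces

open Classical in
/-- The finite set of the sequences that interlace `b` from below. -/
noncomputable def interlacingBelow (b : ℕ →₀ ℕ) : Finset (ℕ →₀ ℕ) :=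
  (Finset.Icc 0 b).filter fun a => Interlaces a b

@[simp]
theorem mem_interlacingBelow {a b : ℕ →₀ ℕ} : a ∈ interlacingBelow b ↔ Interlaces a b := by
  classical
  simp only [interlacingBelow, Finset.mem_filter, Finset.mem_Icc, zero_le, true_and]
  exact ⟨fun h => h.2, fun h => ⟨h.le, h⟩⟩

open Classical in
/-- The number of chains `0 ≺ a₁ ≺ ⋯ ≺ aₖ = b`, that is, the Schur function
`s_b(1, …, 1)` in `k` variables. -/
noncomputable def numChains : ℕ → (ℕ →₀ ℕ) → ℕ
  | 0, b => if b = 0 then 1 else 0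
  | k + 1, b => ∑ a ∈ interlacingBelow b, numChains k a

theorem numChains_succ (k : ℕ) (b : ℕ →₀ ℕ) :
    numChains (k + 1) b = ∑ a ∈ interlacingBelow b, numChains k a := rfl

theorem numChains_succ_tsum (k : ℕ) (b : ℕ →₀ ℕ) :
    (numChains (k + 1) b : ℝ≥0∞) = ∑' a : {a // Interlaces a b}, (numChains k a : ℝ≥0∞) := by
  rw [numChains_succ, Nat.cast_sum]
  rw [← Finset.tsum_subtype (interlacingBelow b) fun a => (numChains k a : ℝ≥0∞)]
  exact (Equiv.subtypeEquivRight fun a => mem_interlacingBelow (a := a) (b := b)).tsum_eq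
    fun a : {a // Interlaces a b} => (numChains k a : ℝ≥0∞)

/-! ### Log-supermodularity of the number of chains -/

theorem numChains_mul_le {m n : ℕ} (hmn : m ≤ n) (x y : ℕ →₀ ℕ) :
    numChains m x * numChains n y ≤ numChains m (x ⊓ y) * numChains n (x ⊔ y) := by
  classical
  induction m generalizing n x y with
  | zero =>
    by_cases hx : x = 0
    · have h0 : (0 : ℕ →₀ ℕ) ⊓ y = 0 := by ext; simp
      have h1 : (0 : ℕ →₀ ℕ) ⊔ y = y := by ext; simp
      rw [hx, h0, h1]
    · simp [numChains, hx]
  | succ m ih =>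
    obtain ⟨n, rfl⟩ : ∃ k, n = k + 1 := ⟨n - 1, by omega⟩
    simp only [numChains_succ]
    refine (four_functions_theorem (numChains m) (numChains n) (numChains m) (numChains n)
      (fun _ => zero_le) (fun _ => zero_le) (fun _ => zero_le)
      (fun _ => zero_le) (fun a b => ih (by omega) a b) (interlacingBelow x)
      (interlacingBelow y)).trans ?_
    gcongr
    · intro c hc
      obtain ⟨a, ha, b, hb, rfl⟩ := Finset.mem_infs.1 hc
      rw [mem_interlacingBelow] at *
      exact ha.inf hb
    · intro c hc
      obtain ⟨a, ha, b, hb, rfl⟩ := Finset.mem_sups.1 hc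
      rw [mem_interlacingBelow] at *
      exact ha.sup hb

theorem tsum_mul_tsum_le_of_four_functions {α : Type*} [DistribLattice α]
    (f₁ f₂ f₃ f₄ : α → ℝ≥0) (h : ∀ a b, f₁ a * f₂ b ≤ f₃ (a ⊓ b) * f₄ (a ⊔ b)) :
    (∑' a, (f₁ a : ℝ≥0∞)) * ∑' a, (f₂ a : ℝ≥0∞) ≤
      (∑' a, (f₃ a : ℝ≥0∞)) * ∑' a, (f₄ a : ℝ≥0∞) := by
  classical
  have key (s t : Finset α) : (∑ a ∈ s, (f₁ a : ℝ≥0∞)) * ∑ a ∈ t, (f₂ a : ℝ≥0∞) ≤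
      (∑' a, (f₃ a : ℝ≥0∞)) * ∑' a, (f₄ a : ℝ≥0∞) := by
    refine le_trans ?_ (mul_le_mul' (ENNReal.sum_le_tsum (s ⊼ t)) (ENNReal.sum_le_tsum (s ⊻ t)))
    exact_mod_cast four_functions_theorem f₁ f₂ f₃ f₄ (fun _ => zero_le) (fun _ => zero_le)
      (fun _ => zero_le) (fun _ => zero_le) h s t
  rw [ENNReal.tsum_eq_iSup_sum, ENNReal.iSup_mul]
  refine iSup_le fun s => ?_
  rw [ENNReal.tsum_eq_iSup_sum (f := fun a => (f₂ a : ℝ≥0∞)), ENNReal.mul_iSup]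
  exact iSup_le fun t => key s t

/-! ### The local growth rule -/

/-- The shift `(a₀, a₁, …) ↦ (0, a₀, a₁, …)`. -/
noncomputable def shiftRight (a : ℕ →₀ ℕ) : ℕ →₀ ℕ := a.embDomain (addRightEmbedding 1)

@[simp] theorem shiftRight_zero_apply (a : ℕ →₀ ℕ) : shiftRight a 0 = 0 :=
  Finsupp.embDomain_of_notMem_range _ _ _ (by simp)

@[simp] theorem shiftRight_succ_apply (a : ℕ →₀ ℕ) (i : ℕ) : shiftRight a (i + 1) = a i :=
  Finsupp.embDomain_apply_self (addRightEmbedding 1) a i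

theorem degree_shiftRight (a : ℕ →₀ ℕ) : (shiftRight a).degree = a.degree := by
  rw [shiftRight, Finsupp.embDomain_eq_mapDomain, Finsupp.degree_mapDomain]

/-- The shift `(a₀, a₁, …) ↦ (a₁, a₂, …)`. -/
noncomputable def shiftLeft (a : ℕ →₀ ℕ) : ℕ →₀ ℕ :=
  a.comapDomain (· + 1) (add_left_injective 1).injOn

@[simp] theorem shiftLeft_apply (a : ℕ →₀ ℕ) (i : ℕ) : shiftLeft a i = a (i + 1) := rfl

/-- The local rule of the row insertion growth diagrams. -/
noncomputable def growth (κ μ ν : ℕ →₀ ℕ) (k : ℕ) : ℕ →₀ ℕ :=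
  μ ⊔ ν + shiftRight (μ ⊓ ν - κ) + Finsupp.single 0 k

@[simp] theorem growth_zero (κ μ ν : ℕ →₀ ℕ) (k : ℕ) : growth κ μ ν k 0 = max (μ 0) (ν 0) + k := by
  simp [growth]

@[simp] theorem growth_succ (κ μ ν : ℕ →₀ ℕ) (k i : ℕ) :
    growth κ μ ν k (i + 1) = max (μ (i + 1)) (ν (i + 1)) + (min (μ i) (ν i) - κ i) := by
  simp [growth]

theorem degree_growth {κ μ ν : ℕ →₀ ℕ} (hμ : κ ≤ μ) (hν : κ ≤ ν) (k : ℕ) :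
    (growth κ μ ν k).degree + κ.degree = μ.degree + ν.degree + k := by
  have h1 : μ ⊓ ν - κ + κ = μ ⊓ ν := tsub_add_cancel_of_le (le_inf hμ hν)
  have h2 : μ ⊔ ν + μ ⊓ ν = μ + ν := by
    ext i; simp only [Finsupp.add_apply, Finsupp.sup_apply, Finsupp.inf_apply]; omega
  have h3 := congrArg Finsupp.degree h1
  have h4 := congrArg Finsupp.degree h2
  rw [map_add] at h3 h4
  rw [map_add] at h4
  rw [growth, map_add, map_add, degree_shiftRight, Finsupp.degree_single]
  omega

/-- The local growth rule is a bijection. -/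
noncomputable def growthEquiv (μ ν : ℕ →₀ ℕ) :
    {κ // Interlaces κ μ ∧ Interlaces κ ν} × ℕ ≃ {β // Interlaces μ β ∧ Interlaces ν β} where
  toFun p := ⟨growth p.1 μ ν p.2, by
    obtain ⟨⟨κ, h1, h2⟩, k⟩ := p
    constructor <;> rintro (_ | i) <;> simp only [growth_zero, growth_succ]
    · have := h1 0; have := h2 0; omega
    · have := h1 i; have := h2 i; have := h1 (i + 1); have := h2 (i + 1); omega
    · have := h1 0; have := h2 0; omega
    · have := h1 i; have := h2 i; have := h1 (i + 1); have := h2 (i + 1); omega⟩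
  invFun β := ⟨⟨μ ⊓ ν - shiftLeft (β - μ ⊔ ν), by
    obtain ⟨β, h1, h2⟩ := β
    constructor <;> intro i <;>
      simp only [Finsupp.tsub_apply, Finsupp.inf_apply, shiftLeft_apply, Finsupp.sup_apply] <;>
      have := h1 i <;> have := h2 i <;> have := h1 (i + 1) <;> have := h2 (i + 1) <;> omega⟩,
    β.1 0 - max (μ 0) (ν 0)⟩
  left_inv := by
    rintro ⟨⟨κ, h1, h2⟩, k⟩
    ext i
    · have := h1 i; have := h2 i
      simp only [Finsupp.tsub_apply, Finsupp.inf_apply, shiftLeft_apply, Finsupp.sup_apply,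
        growth_succ]
      omega
    · simp
  right_inv := by
    rintro ⟨β, h1, h2⟩
    ext (_ | i)
    · have := h1 0; have := h2 0
      simp only [growth_zero]; omega
    · have := h1 i; have := h2 i; have := h1 (i + 1); have := h2 (i + 1)
      simp only [growth_succ, Finsupp.tsub_apply, Finsupp.inf_apply, shiftLeft_apply,
        Finsupp.sup_apply]
      omega

/-! ### The skew Cauchy identity -/

theorem tsum_subtype_comm {α β : Type*} (P : α → Prop) (R : α → β → Prop) (f : α → β → ℝ≥0∞) :
    ∑' a : {a // P a}, ∑' b : {b // R a b}, f a b =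
      ∑' b, ∑' a : {a // P a ∧ R a b}, f a b := by
  rw [← ENNReal.tsum_sigma' fun p : (a : {a // P a}) × {b // R a b} => f p.1 p.2,
    ← ENNReal.tsum_sigma' fun p : (b : β) × {a // P a ∧ R a b} => f p.2 p.1]
  exact Equiv.tsum_eq (f := fun p : (b : β) × {a // P a ∧ R a b} => f p.2 p.1)
    ({ toFun := fun p => ⟨p.2, p.1, p.1.2, p.2.2⟩
       invFun := fun p => ⟨⟨p.2, p.2.2.1⟩, p.1, p.2.2.2⟩
       left_inv := fun _ => rfl
       right_inv := fun _ => rfl } :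
      ((a : {a // P a}) × {b // R a b}) ≃ ((b : β) × {a // P a ∧ R a b}))

theorem tsum_growth (μ ν : ℕ →₀ ℕ) (F : (ℕ →₀ ℕ) → ℕ → ℝ≥0∞)
    (H : (ℕ →₀ ℕ) → ℝ≥0∞)
    (h : ∀ κ k, Interlaces κ μ → Interlaces κ ν → F κ k = H (growth κ μ ν k)) :
    ∑' κ : {κ // Interlaces κ μ ∧ Interlaces κ ν}, ∑' k, F κ k =
      ∑' β : {β // Interlaces μ β ∧ Interlaces ν β}, H β := by
  rw [← (growthEquiv μ ν).tsum_eq, ENNReal.tsum_prod']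
  exact tsum_congr fun κ => tsum_congr fun k => h κ k κ.2.1 κ.2.2

theorem degree_growth_eq {κ μ ν : ℕ →₀ ℕ} (hμ : κ ≤ μ) (hν : κ ≤ ν) (k : ℕ) :
    (growth κ μ ν k).degree = μ.degree - κ.degree + ν.degree + k := by
  have h1 := degree_growth hμ hν k
  have h2 := Finsupp.degree_mono hμ
  omega

/-- The geometric series `1 + x + x² + ⋯`. -/
noncomputable def geomSum (x : ℝ≥0∞) : ℝ≥0∞ := ∑' k : ℕ, x ^ k

/-- The skew Cauchy identity at `(1, …, 1)`. -/
theorem tsum_interlaces_numChains (x : ℝ≥0∞) (n : ℕ) (lam : ℕ →₀ ℕ) :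
    ∑' μ : {μ // Interlaces lam μ}, (numChains n μ : ℝ≥0∞) * x ^ (μ : ℕ →₀ ℕ).degree =
      geomSum x ^ n * (numChains n lam * x ^ lam.degree) := by
  induction n generalizing lam with
  | zero =>
    have h0 (μ : ℕ →₀ ℕ) : (numChains 0 μ : ℝ≥0∞) * x ^ μ.degree = if μ = 0 then 1 else 0 := by
      by_cases h : μ = 0 <;> simp [numChains, h]
    simp only [h0, pow_zero, one_mul]
    by_cases h : lam = 0
    · subst h
      rw [tsum_eq_single ⟨0, fun i => by simp⟩ fun b hb => if_neg fun h => hb (Subtype.ext h)]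
    · rw [if_neg h, ENNReal.tsum_eq_zero]
      rintro ⟨μ, hμ⟩
      refine if_neg ?_
      rintro rfl
      exact h (le_antisymm hμ.le zero_le)
  | succ n ih =>
    calc ∑' μ : {μ // Interlaces lam μ},
          (numChains (n + 1) μ : ℝ≥0∞) * x ^ (μ : ℕ →₀ ℕ).degree
        = ∑' μ : {μ // Interlaces lam μ}, ∑' ν : {ν // Interlaces ν μ},
          (numChains n ν : ℝ≥0∞) * x ^ (μ : ℕ →₀ ℕ).degree := by
          refine tsum_congr fun μ => ?_
          rw [numChains_succ_tsum, ENNReal.tsum_mul_right]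
      _ = ∑' ν, ∑' μ : {μ // Interlaces lam μ ∧ Interlaces ν μ},
          (numChains n ν : ℝ≥0∞) * x ^ (μ : ℕ →₀ ℕ).degree :=
          tsum_subtype_comm (fun μ => Interlaces lam μ) (fun μ ν => Interlaces ν μ)
            fun μ ν => (numChains n ν : ℝ≥0∞) * x ^ μ.degree
      _ = ∑' ν, ∑' κ : {κ // Interlaces κ lam ∧ Interlaces κ ν},
          geomSum x * (x ^ (lam.degree - (κ : ℕ →₀ ℕ).degree) *
            (numChains n ν * x ^ ν.degree)) := by
          refine tsum_congr fun ν => ?_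
          rw [← tsum_growth lam ν (fun κ k => x ^ k * (x ^ (lam.degree - κ.degree) *
            (numChains n ν * x ^ ν.degree))) fun μ => (numChains n ν : ℝ≥0∞) * x ^ μ.degree]
          · simp only [ENNReal.tsum_mul_right, geomSum]
          · intro κ k h1 h2
            rw [degree_growth_eq h1.le h2.le, pow_add, pow_add]
            ring
      _ = ∑' κ : {κ // Interlaces κ lam}, ∑' ν : {ν // Interlaces κ ν},
          geomSum x * (x ^ (lam.degree - (κ : ℕ →₀ ℕ).degree) *
            (numChains n ν * x ^ (ν : ℕ →₀ ℕ).degree)) :=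
          (tsum_subtype_comm (fun κ => Interlaces κ lam) (fun κ ν => Interlaces κ ν)
            fun κ ν => geomSum x * (x ^ (lam.degree - κ.degree) *
              (numChains n ν * x ^ ν.degree))).symm
      _ = ∑' κ : {κ // Interlaces κ lam}, geomSum x ^ (n + 1) *
          (numChains n κ * x ^ lam.degree) := by
          refine tsum_congr fun κ => ?_
          simp only [ENNReal.tsum_mul_left]
          rw [ih, ← Nat.sub_add_cancel (Finsupp.degree_mono κ.2.le), pow_add x,
            Nat.sub_add_cancel (Finsupp.degree_mono κ.2.le)]
          ring
      _ = _ := by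
          rw [ENNReal.tsum_mul_left, ENNReal.tsum_mul_right, numChains_succ_tsum]

/-! ### The distribution function of the first part under the Schur measure -/

/-- The unnormalised distribution function of the first part under the Schur measure with
specialisations `(1, …, 1)` and `(x, …, x)` in `m` and `n` variables. -/
noncomputable def schurCDF (x : ℝ≥0∞) (m n t : ℕ) : ℝ≥0∞ :=
  ∑' μ : {μ : ℕ →₀ ℕ // μ 0 ≤ t},
    (numChains m μ : ℝ≥0∞) * (numChains n μ * x ^ (μ : ℕ →₀ ℕ).degree)

theorem schurCDF_comm (x : ℝ≥0∞) (m n t : ℕ) : schurCDF x m n t = schurCDF x n m t :=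
  tsum_congr fun _ => mul_left_comm _ _ _

theorem schurCDF_mono (x : ℝ≥0∞) (m n : ℕ) : Monotone (schurCDF x m n) := fun _ _ h =>
  ENNReal.tsum_mono_subtype (fun μ : ℕ →₀ ℕ => (numChains m μ : ℝ≥0∞) *
    (numChains n μ * x ^ μ.degree)) (s := {μ | μ 0 ≤ _}) (t := {μ | μ 0 ≤ _})
    fun _ hμ => le_trans hμ h

theorem schurCDF_succ (x : ℝ≥0∞) (m n t : ℕ) :
    schurCDF x (m + 1) n t = ∑' lam, (numChains m lam : ℝ≥0∞) *
      ∑' μ : {μ // μ 0 ≤ t ∧ Interlaces lam μ},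
        (numChains n μ : ℝ≥0∞) * x ^ (μ : ℕ →₀ ℕ).degree := by
  simp only [schurCDF, numChains_succ_tsum, ← ENNReal.tsum_mul_right, ← ENNReal.tsum_mul_left]
  exact tsum_subtype_comm (fun μ : ℕ →₀ ℕ => μ 0 ≤ t) (fun μ ν => Interlaces ν μ)
    fun μ ν => (numChains m ν : ℝ≥0∞) * (numChains n μ * x ^ μ.degree)

theorem degree_inf_add_degree_sup (a b : ℕ →₀ ℕ) :
    (a ⊓ b).degree + (a ⊔ b).degree = a.degree + b.degree := by
  rw [← map_add, ← map_add]
  congr 1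
  ext i
  simp only [Finsupp.add_apply, Finsupp.sup_apply, Finsupp.inf_apply]; omega

theorem tsum_interlaces_mul_le {m n : ℕ} (hmn : m ≤ n) (x : ℝ≥0) (t : ℕ) (lam : ℕ →₀ ℕ) :
    (∑' μ : {μ // Interlaces lam μ}, (numChains m μ : ℝ≥0∞) * x ^ (μ : ℕ →₀ ℕ).degree) *
      (∑' μ : {μ // μ 0 ≤ t ∧ Interlaces lam μ},
        (numChains n μ : ℝ≥0∞) * x ^ (μ : ℕ →₀ ℕ).degree) ≤
    (∑' μ : {μ // μ 0 ≤ t ∧ Interlaces lam μ},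
        (numChains m μ : ℝ≥0∞) * x ^ (μ : ℕ →₀ ℕ).degree) *
      ∑' μ : {μ // Interlaces lam μ}, (numChains n μ : ℝ≥0∞) * x ^ (μ : ℕ →₀ ℕ).degree := by
  classical
  have key (P : (ℕ →₀ ℕ) → Prop) (k : ℕ) :
      ∑' μ : {μ // P μ}, (numChains k μ : ℝ≥0∞) * x ^ (μ : ℕ →₀ ℕ).degree =
        ∑' μ, (((if P μ then numChains k μ * x ^ μ.degree else 0 : ℝ≥0)) : ℝ≥0∞) := by
    refine (tsum_subtype {μ | P μ} fun μ => (numChains k μ : ℝ≥0∞) * x ^ μ.degree).trans ?_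
    refine tsum_congr fun μ => ?_
    by_cases h : P μ <;> simp [h]
  simp only [key]
  refine tsum_mul_tsum_le_of_four_functions _ _ _ _ fun a b => ?_
  split_ifs with h1 h2 h3 h4 h5 <;> try simp
  · have h6 := numChains_mul_le hmn a b
    calc (numChains m a : ℝ≥0) * x ^ a.degree * (numChains n b * x ^ b.degree)
        = ((numChains m a * numChains n b : ℕ) : ℝ≥0) * x ^ (a.degree + b.degree) := by
          push_cast; ring
      _ ≤ ((numChains m (a ⊓ b) * numChains n (a ⊔ b) : ℕ) : ℝ≥0) * x ^ (a.degree + b.degree) := by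
          gcongr
      _ = _ := by rw [← degree_inf_add_degree_sup]; push_cast; ring
  · exact (h4 (by simpa using h1.sup h2.2)).elim
  · exact (h3 ⟨by simp [h2.1], by simpa using h1.inf h2.2⟩).elim
  · exact (h3 ⟨by simp [h2.1], by simpa using h1.inf h2.2⟩).elim

theorem schurCDF_succ_le {m n : ℕ} (hmn : m ≤ n) {x : ℝ≥0} (hx : x ≠ 0) (t : ℕ) :
    geomSum x ^ m * schurCDF x (m + 1) n t ≤ geomSum x ^ n * schurCDF x m (n + 1) t := by
  rw [schurCDF_comm _ m, schurCDF_succ, schurCDF_succ, ← ENNReal.tsum_mul_left,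
    ← ENNReal.tsum_mul_left]
  refine ENNReal.tsum_le_tsum fun lam => ?_
  have h := tsum_interlaces_mul_le hmn x t lam
  rw [tsum_interlaces_numChains, tsum_interlaces_numChains] at h
  have h0 : (x : ℝ≥0∞) ^ lam.degree ≠ 0 := pow_ne_zero _ (by simpa using hx)
  have h1 : (x : ℝ≥0∞) ^ lam.degree ≠ ⊤ := by simp
  refine (ENNReal.mul_le_mul_iff_left h0 h1).1 ?_
  convert h using 1 <;> ring

/-! ### Growth of chains of partitions -/

theorem tsum_comm_subtype {α β : Type*} (R : α → β → Prop) (f : α → β → ℝ≥0∞) :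
    ∑' a, ∑' b : {b // R a b}, f a b = ∑' b, ∑' a : {a // R a b}, f a b := by
  rw [← ENNReal.tsum_sigma' fun p : (a : α) × {b // R a b} => f p.1 p.2,
    ← ENNReal.tsum_sigma' fun p : (b : β) × {a // R a b} => f p.2 p.1]
  exact Equiv.tsum_eq (f := fun p : (b : β) × {a // R a b} => f p.2 p.1)
    ({ toFun := fun p => ⟨p.2, p.1, p.2.2⟩
       invFun := fun p => ⟨p.2, p.1, p.2.2⟩
       left_inv := fun _ => rfl
       right_inv := fun _ => rfl } :
      ((a : α) × {b // R a b}) ≃ ((b : β) × {a // R a b}))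

theorem tsum_of_unique {X : Type*} [Unique X] (F : X → ℝ≥0∞) : ∑' a, F a = F default :=
  tsum_eq_single default fun _ ha => (ha (Subsingleton.elim _ _)).elim

theorem tsum_fin_snoc {X : Type*} (m : ℕ) (F : (Fin (m + 1) → X) → ℝ≥0∞) :
    ∑' w, F w = ∑' (w : Fin m → X) (k : X), F (Fin.snoc w k) := by
  rw [← (Fin.snocEquiv fun _ : Fin (m + 1) => X).tsum_eq, ENNReal.tsum_prod', ENNReal.tsum_comm]
  rfl

/-- The last entry of a chain of sequences, with the convention that it is `0` for the empty
chain. -/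
noncomputable def chainTop : (m : ℕ) → (Fin m → ℕ →₀ ℕ) → ℕ →₀ ℕ
  | 0, _ => 0
  | m + 1, a => a (Fin.last m)

@[simp] theorem chainTop_zero (a : Fin 0 → ℕ →₀ ℕ) : chainTop 0 a = 0 := rfl

@[simp] theorem chainTop_snoc (m : ℕ) (a : Fin m → ℕ →₀ ℕ) (β : ℕ →₀ ℕ) :
    chainTop (m + 1) (Fin.snoc a β) = β := by simp [chainTop]

/-- `0 ≺ a 0 ≺ a 1 ≺ ⋯ ≺ a (m - 1)`. -/
def IsInterlacingChain : (m : ℕ) → (Fin m → ℕ →₀ ℕ) → Prop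
  | 0, _ => True
  | m + 1, a => IsInterlacingChain m (Fin.init a) ∧
      Interlaces (chainTop m (Fin.init a)) (a (Fin.last m))

theorem isInterlacingChain_snoc {m : ℕ} {a : Fin m → ℕ →₀ ℕ} {β : ℕ →₀ ℕ} :
    IsInterlacingChain (m + 1) (Fin.snoc a β) ↔
      IsInterlacingChain m a ∧ Interlaces (chainTop m a) β := by
  simp [IsInterlacingChain]

theorem tsum_chain_zero (F : (Fin 0 → ℕ →₀ ℕ) → ℝ≥0∞) :
    ∑' a : {a // IsInterlacingChain 0 a}, F a = F ![] :=
  tsum_eq_single ⟨![], trivial⟩ fun _ ha => (ha (Subtype.ext (Subsingleton.elim _ _))).elim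

theorem tsum_chain_succ (m : ℕ) (F : (Fin (m + 1) → ℕ →₀ ℕ) → ℝ≥0∞) :
    ∑' a : {a // IsInterlacingChain (m + 1) a}, F a =
      ∑' (a : {a // IsInterlacingChain m a}) (β : {β // Interlaces (chainTop m a) β}),
        F (Fin.snoc (α := fun _ => ℕ →₀ ℕ) a.1 β.1) := by
  rw [← ENNReal.tsum_sigma' fun p : (a : {a // IsInterlacingChain m a}) ×
    {β // Interlaces (chainTop m a) β} => F (Fin.snoc (α := fun _ => ℕ →₀ ℕ) p.1.1 p.2.1)]
  refine (Equiv.tsum_eq (f := fun a : {a // IsInterlacingChain (m + 1) a} => F a)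
    ({ toFun := fun p => ⟨Fin.snoc (α := fun _ => ℕ →₀ ℕ) p.1.1 p.2.1,
        isInterlacingChain_snoc.2 ⟨p.1.2, p.2.2⟩⟩
       invFun := fun a => ⟨⟨Fin.init a.1, a.2.1⟩, a.1 (Fin.last m), a.2.2⟩
       left_inv := ?_
       right_inv := ?_ } : ((a : {a // IsInterlacingChain m a}) ×
        {β // Interlaces (chainTop m a) β}) ≃ {a // IsInterlacingChain (m + 1) a})).symm
  · rintro ⟨⟨a, ha⟩, β, hβ⟩
    exact Sigma.subtype_ext (Subtype.ext (Fin.init_snoc (α := fun _ => ℕ →₀ ℕ) _ _))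
      (Fin.snoc_last (α := fun _ => ℕ →₀ ℕ) _ _)
  · rintro ⟨a, ha⟩
    exact Subtype.ext (Fin.snoc_init_self a)

/-- The number of chains with a given last entry is `numChains`. -/
theorem tsum_chain_chainTop (m : ℕ) (f : (ℕ →₀ ℕ) → ℝ≥0∞) :
    ∑' a : {a // IsInterlacingChain m a}, f (chainTop m a) = ∑' μ, numChains m μ * f μ := by
  induction m generalizing f with
  | zero =>
    rw [tsum_chain_zero fun a => f (chainTop 0 a), tsum_eq_single 0]
    · simp [numChains]
    · intro b hb; simp [numChains, hb]
  | succ m ih =>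
    rw [tsum_chain_succ m fun a => f (chainTop (m + 1) a)]
    simp only [chainTop_snoc]
    rw [ih fun ν => ∑' β : {β // Interlaces ν β}, f β]
    simp only [numChains_succ_tsum, ← ENNReal.tsum_mul_left, ← ENNReal.tsum_mul_right]
    exact tsum_comm_subtype (fun ν β => Interlaces ν β) fun ν β => (numChains m ν : ℝ≥0∞) * f β

theorem chain_eq_zero {m : ℕ} {a : Fin m → ℕ →₀ ℕ} (ha : IsInterlacingChain m a)
    (h : chainTop m a = 0) : a = 0 := by
  induction m with
  | zero => exact Subsingleton.elim _ _
  | succ m ih =>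
    have h1 : a (Fin.last m) = 0 := h
    have h2 : Fin.init a = 0 :=
      ih ha.1 (le_antisymm (by rw [← h1]; exact ha.2.le) zero_le)
    ext i
    refine Fin.lastCases ?_ (fun i => ?_) i
    · rw [h1]; rfl
    · exact DFunLike.congr_fun (congrFun h2 i) _

theorem isInterlacingChain_zero (m : ℕ) : IsInterlacingChain m 0 := by
  induction m with
  | zero => trivial
  | succ m ih =>
    refine ⟨ih, fun i => ?_⟩
    cases m <;> simp [chainTop, Fin.init]

/-- One column of the growth diagram: the chain `a` in one column and the weights `w` determine
the chain in the next column. -/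
noncomputable def insertColumn : (m : ℕ) → (Fin m → ℕ →₀ ℕ) → (Fin m → ℕ) → Fin m → ℕ →₀ ℕ
  | 0, _, _ => ![]
  | m + 1, a, w =>
    Fin.snoc (α := fun _ => ℕ →₀ ℕ) (insertColumn m (Fin.init a) (Fin.init w))
      (growth (chainTop m (Fin.init a)) (chainTop m (insertColumn m (Fin.init a) (Fin.init w)))
        (a (Fin.last m)) (w (Fin.last m)))

theorem insertColumn_snoc (m : ℕ) (a : Fin m → ℕ →₀ ℕ) (α : ℕ →₀ ℕ) (w : Fin m → ℕ) (k : ℕ) :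
    insertColumn (m + 1) (Fin.snoc (α := fun _ => ℕ →₀ ℕ) a α) (Fin.snoc (α := fun _ => ℕ) w k) =
      Fin.snoc (α := fun _ => ℕ →₀ ℕ) (insertColumn m a w)
        (growth (chainTop m a) (chainTop m (insertColumn m a w)) α k) := by
  simp [insertColumn]

theorem tsum_insertColumn (x : ℝ≥0∞) (m : ℕ) (H : (ℕ →₀ ℕ) → (Fin m → ℕ →₀ ℕ) → ℝ≥0∞) :
    ∑' (a : {a // IsInterlacingChain m a}) (w : Fin m → ℕ),
        x ^ (∑ i, w i) * H (chainTop m a) (insertColumn m a w) =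
      ∑' (b : {b // IsInterlacingChain m b}) (α : {α // Interlaces α (chainTop m b)}),
        x ^ ((chainTop m b).degree - (α : ℕ →₀ ℕ).degree) * H α b := by
  induction m with
  | zero =>
    rw [tsum_chain_zero fun a => ∑' w : Fin 0 → ℕ,
        x ^ (∑ i, w i) * H (chainTop 0 a) (insertColumn 0 a w),
      tsum_chain_zero fun b => ∑' α : {α // Interlaces α (chainTop 0 b)},
        x ^ ((chainTop 0 b).degree - (α : ℕ →₀ ℕ).degree) * H α b, tsum_of_unique,
      tsum_eq_single ⟨0, fun i => by simp⟩]
    · simp [insertColumn]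
    · rintro ⟨b, hb⟩ hb'
      exact (hb' (Subtype.ext (le_antisymm hb.le zero_le))).elim
  | succ m ih =>
    rw [tsum_chain_succ m fun a => ∑' w : Fin (m + 1) → ℕ,
        x ^ (∑ i, w i) * H (chainTop (m + 1) a) (insertColumn (m + 1) a w),
      tsum_chain_succ m fun b => ∑' α : {α // Interlaces α (chainTop (m + 1) b)},
        x ^ ((chainTop (m + 1) b).degree - (α : ℕ →₀ ℕ).degree) * H α b]
    simp only [tsum_fin_snoc, insertColumn_snoc, chainTop_snoc, Fin.sum_univ_castSucc,
      Fin.snoc_castSucc, Fin.snoc_last]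
    calc _ = ∑' (a : {a // IsInterlacingChain m a}) (w : Fin m → ℕ), x ^ (∑ i, w i) *
          ∑' α : {α // Interlaces (chainTop m a) α}, ∑' k : ℕ, x ^ k *
            H α (Fin.snoc (α := fun _ => ℕ →₀ ℕ) (insertColumn m a w)
              (growth (chainTop m a) (chainTop m (insertColumn m a w)) α k)) := by
          refine tsum_congr fun a => ?_
          rw [ENNReal.tsum_comm]
          simp only [← ENNReal.tsum_mul_left, pow_add, mul_assoc]
      _ = _ := ih fun κ b => ∑' α : {α // Interlaces κ α}, ∑' k : ℕ, x ^ k *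
            H α (Fin.snoc (α := fun _ => ℕ →₀ ℕ) b (growth κ (chainTop m b) α k))
      _ = _ := by
          refine tsum_congr fun b => ?_
          have h0 (β : ℕ →₀ ℕ) : ∑' α : {α // Interlaces α
              (chainTop (m + 1) (Fin.snoc (α := fun _ => ℕ →₀ ℕ) b.1 β))},
                x ^ (β.degree - (α : ℕ →₀ ℕ).degree) * H α (Fin.snoc b.1 β) =
              ∑' α : {α // Interlaces α β}, x ^ (β.degree - (α : ℕ →₀ ℕ).degree) *
                H α (Fin.snoc (α := fun _ => ℕ →₀ ℕ) b.1 β) := by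
            rw [chainTop_snoc]
          simp only [← ENNReal.tsum_mul_left, h0]
          rw [tsum_subtype_comm (fun κ => Interlaces κ (chainTop m b.1))
            (fun κ α => Interlaces κ α) fun κ α => ∑' k : ℕ,
              x ^ ((chainTop m b.1).degree - κ.degree) * (x ^ k *
                H α (Fin.snoc (α := fun _ => ℕ →₀ ℕ) b.1 (growth κ (chainTop m b.1) α k))),
            tsum_subtype_comm (fun β => Interlaces (chainTop m b.1) β)
              (fun β α => Interlaces α β) fun β α =>
              x ^ (β.degree - α.degree) * H α (Fin.snoc (α := fun _ => ℕ →₀ ℕ) b.1 β)]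
          refine tsum_congr fun α => ?_
          refine tsum_growth (chainTop m b.1) α (fun κ k =>
              x ^ ((chainTop m b.1).degree - κ.degree) * (x ^ k *
                H α (Fin.snoc (α := fun _ => ℕ →₀ ℕ) b.1 (growth κ (chainTop m b.1) α k))))
            (fun β => x ^ (β.degree - α.degree) * H α (Fin.snoc (α := fun _ => ℕ →₀ ℕ) b.1 β))
            fun κ k h1 h2 => ?_
          rw [degree_growth_eq h1.le h2.le, ← mul_assoc, ← pow_add]
          congr 2
          omega

/-- The last column of the growth diagram of the weights `W j i` (`j` the column, `i` the row). -/
noncomputable def growthColumns (m : ℕ) : (n : ℕ) → (Fin n → Fin m → ℕ) → Fin m → ℕ →₀ ℕ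
  | 0, _ => 0
  | n + 1, W => insertColumn m (growthColumns m n (Fin.init W)) (W (Fin.last n))

theorem tsum_growthColumns (x : ℝ≥0∞) (m n : ℕ) (g : (Fin m → ℕ →₀ ℕ) → ℝ≥0∞) :
    ∑' W : Fin n → Fin m → ℕ, x ^ (∑ j, ∑ i, W j i) * g (growthColumns m n W) =
      ∑' a : {a // IsInterlacingChain m a},
        numChains n (chainTop m a) * x ^ (chainTop m a.1).degree * g a := by
  induction n generalizing g with
  | zero =>
    rw [tsum_of_unique, tsum_eq_single ⟨0, isInterlacingChain_zero m⟩]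
    · have h : chainTop m 0 = 0 := by cases m <;> rfl
      simp [growthColumns, h, numChains]
    · rintro ⟨b, hb⟩ hb'
      have h : chainTop m b ≠ 0 := fun h => hb' (Subtype.ext (chain_eq_zero hb h))
      simp [numChains, h]
  | succ n ih =>
    simp only [tsum_fin_snoc (X := Fin m → ℕ), Fin.sum_univ_castSucc, Fin.snoc_castSucc,
      Fin.snoc_last, growthColumns, Fin.init_snoc]
    calc _ = ∑' W : Fin n → Fin m → ℕ, x ^ (∑ j, ∑ i, W j i) *
          ∑' w : Fin m → ℕ, x ^ (∑ i, w i) * g (insertColumn m (growthColumns m n W) w) := by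
          simp only [← ENNReal.tsum_mul_left, pow_add, mul_assoc]
      _ = _ := ih fun a => ∑' w : Fin m → ℕ, x ^ (∑ i, w i) * g (insertColumn m a w)
      _ = ∑' (a : {a // IsInterlacingChain m a}) (w : Fin m → ℕ), x ^ (∑ i, w i) *
          (numChains n (chainTop m a) * x ^ (chainTop m a.1).degree *
            g (insertColumn m a w)) := by
          simp only [← ENNReal.tsum_mul_left]
          refine tsum_congr fun a => tsum_congr fun w => ?_
          ring
      _ = _ := tsum_insertColumn x m fun α b => numChains n α * x ^ α.degree * g b
      _ = _ := by
          refine tsum_congr fun b => ?_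
          rw [numChains_succ_tsum, ← ENNReal.tsum_mul_right, ← ENNReal.tsum_mul_right]
          refine tsum_congr fun α => ?_
          have h := Finsupp.degree_mono α.2.le
          rw [show x ^ (chainTop m b.1).degree = x ^ ((chainTop m b.1).degree -
            (α : ℕ →₀ ℕ).degree) * x ^ (α : ℕ →₀ ℕ).degree by
              rw [← pow_add, Nat.sub_add_cancel h]]
          ring

theorem tsum_chainTop_growthColumns (x : ℝ≥0∞) (m n : ℕ) (f : (ℕ →₀ ℕ) → ℝ≥0∞) :
    ∑' W : Fin n → Fin m → ℕ, x ^ (∑ j, ∑ i, W j i) * f (chainTop m (growthColumns m n W)) =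
      ∑' μ, numChains m μ * (numChains n μ * x ^ μ.degree * f μ) :=
  (tsum_growthColumns x m n fun a => f (chainTop m a)).trans
    (tsum_chain_chainTop m fun μ => numChains n μ * x ^ μ.degree * f μ)

/-! ### Last passage times -/

/-- The last passage times, by their recursion. -/
def passageTime (w : ℕ × ℕ → ℕ) : ℕ → ℕ → ℕ
  | 0, _ => 0
  | _ + 1, 0 => 0
  | i + 1, j + 1 => max (passageTime w i (j + 1)) (passageTime w (i + 1) j) + w (i + 1, j + 1)

@[simp] theorem passageTime_zero_left (w : ℕ × ℕ → ℕ) (j : ℕ) : passageTime w 0 j = 0 := by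
  rw [passageTime]

@[simp] theorem passageTime_zero_right (w : ℕ × ℕ → ℕ) (i : ℕ) : passageTime w i 0 = 0 := by
  cases i <;> rw [passageTime]

theorem passageTime_succ (w : ℕ × ℕ → ℕ) (i j : ℕ) : passageTime w (i + 1) (j + 1) =
    max (passageTime w i (j + 1)) (passageTime w (i + 1) j) + w (i + 1, j + 1) := by
  rw [passageTime]

theorem chainTop_apply_zero {m : ℕ} {a : Fin m → ℕ →₀ ℕ} {c : ℕ → ℕ} (h0 : c 0 = 0)
    (h : ∀ i : Fin m, a i 0 = c (i + 1)) : chainTop m a 0 = c m := by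
  cases m with
  | zero => simp [h0]
  | succ m => exact h (Fin.last m)

theorem insertColumn_apply_zero {m : ℕ} {a : Fin m → ℕ →₀ ℕ} {v : Fin m → ℕ} {c d : ℕ → ℕ}
    (hd0 : d 0 = 0) (hd : ∀ i : Fin m, d (i + 1) = max (d i) (c (i + 1)) + v i)
    (ha : ∀ i : Fin m, a i 0 = c (i + 1)) (i : Fin m) : insertColumn m a v i 0 = d (i + 1) := by
  induction m with
  | zero => exact i.elim0
  | succ m ih =>
    have key := ih (a := Fin.init a) (v := Fin.init v) (fun i => hd i.castSucc)
      (fun i => ha i.castSucc)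
    refine Fin.lastCases ?_ (fun i => ?_) i
    · have h1 := hd (Fin.last m)
      simp only [Fin.val_last] at h1
      simp [insertColumn, chainTop_apply_zero hd0 key, ha, h1]
    · simpa [insertColumn] using key i

theorem growthColumns_apply_zero (w : ℕ × ℕ → ℕ) (m n : ℕ) (i : Fin m) :
    growthColumns m n (fun j i => w (i + 1, j + 1)) i 0 = passageTime w (i + 1) n := by
  induction n generalizing i with
  | zero => simp [growthColumns]
  | succ n ih =>
    exact insertColumn_apply_zero (c := fun i => passageTime w i n)
      (d := fun i => passageTime w i (n + 1)) (passageTime_zero_left w _)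
      (fun i => passageTime_succ w i n) ih i

theorem chainTop_growthColumns_apply_zero (w : ℕ × ℕ → ℕ) (m n : ℕ) :
    chainTop m (growthColumns m n fun j i => w (i + 1, j + 1)) 0 = passageTime w m n :=
  chainTop_apply_zero (c := fun i => passageTime w i n) (passageTime_zero_left w _)
    (growthColumns_apply_zero w m n)

theorem IsUpRightPath.sum_le {w : ℕ × ℕ → ℕ} {m n : ℕ} {p : List (ℕ × ℕ)}
    (h : IsUpRightPath m n p) : (p.map w).sum ≤ passageTime w m n := by
  suffices H : 1 ≤ m ∧ 1 ≤ n ∧ (p.map w).sum ≤ passageTime w m n from H.2.2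
  induction p using List.reverseRecOn generalizing m n with
  | nil => simp [IsUpRightPath] at h
  | append_singleton l v ih =>
    obtain ⟨h1, h2, h3⟩ := h
    obtain rfl : v = (m, n) := by simpa using h2
    rcases List.eq_nil_or_concat l with rfl | ⟨l', u, rfl⟩
    · obtain ⟨rfl, rfl⟩ : m = 1 ∧ n = 1 := by simpa using h1
      simp [passageTime_succ]
    · rw [List.isChain_append] at h3
      obtain ⟨i, j⟩ := u
      have h4 : UpRightStep (i, j) (m, n) := h3.2.2 _ (by simp) _ (by simp)
      obtain ⟨hi, hj, hs⟩ := ih (m := i) (n := j) ⟨by simpa using h1, by simp, h3.1⟩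
      rw [List.map_append, List.sum_append, List.map_singleton, List.sum_singleton]
      simp only [UpRightStep, Prod.mk.injEq] at h4
      rcases h4 with ⟨rfl, rfl⟩ | ⟨rfl, rfl⟩
      · obtain ⟨n, rfl⟩ : ∃ k, n = k + 1 := ⟨n - 1, by omega⟩
        rw [passageTime_succ]; omega
      · obtain ⟨m, rfl⟩ : ∃ k, m = k + 1 := ⟨m - 1, by omega⟩
        rw [passageTime_succ]; omega

theorem IsUpRightPath.append {m n m' n' : ℕ} {p : List (ℕ × ℕ)} (h : IsUpRightPath m n p)
    (hs : UpRightStep (m, n) (m', n')) : IsUpRightPath m' n' (p ++ [(m', n')]) := by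
  obtain ⟨h1, h2, h3⟩ := h
  refine ⟨by simp [h1], by simp, List.isChain_append.2 ⟨h3, by simp, ?_⟩⟩
  intro x hx y hy
  simp_all

theorem exists_isUpRightPath_sum_eq (w : ℕ × ℕ → ℕ) (m n : ℕ) :
    ∃ p, IsUpRightPath (m + 1) (n + 1) p ∧ (p.map w).sum = passageTime w (m + 1) (n + 1) := by
  have left (m n : ℕ) (h : passageTime w (m + 1) (n + 1) ≤ passageTime w m (n + 2))
      (H : ∃ p, IsUpRightPath m (n + 2) p ∧ (p.map w).sum = passageTime w m (n + 2)) :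
      ∃ p, IsUpRightPath (m + 1) (n + 2) p ∧
        (p.map w).sum = passageTime w (m + 1) (n + 2) := by
    obtain ⟨p, hp, hs⟩ := H
    refine ⟨_, hp.append (Or.inl rfl), ?_⟩
    simp [passageTime_succ w m (n + 1), hs, h]
  induction m generalizing n with
  | zero =>
    induction n with
    | zero => exact ⟨[(1, 1)], by simp [IsUpRightPath], by simp [passageTime_succ]⟩
    | succ n ihn =>
      obtain ⟨p, hp, hs⟩ := ihn
      refine ⟨_, hp.append (Or.inr rfl), ?_⟩
      simp [passageTime_succ w 0 (n + 1), hs]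
  | succ m ihm =>
    induction n with
    | zero =>
      obtain ⟨p, hp, hs⟩ := ihm 0
      refine ⟨_, hp.append (Or.inl rfl), ?_⟩
      simp [passageTime_succ w (m + 1) 0, hs]
    | succ n ihn =>
      rcases le_total (passageTime w (m + 1 + 1) (n + 1)) (passageTime w (m + 1) (n + 2))
        with h | h
      · exact left _ _ h (ihm (n + 1))
      · obtain ⟨p, hp, hs⟩ := ihn
        refine ⟨_, hp.append (Or.inr rfl), ?_⟩
        simp [passageTime_succ w (m + 1) (n + 1), hs, h]

theorem lastPassage_eq_passageTime {Ω : Type*} (w : ℕ × ℕ → Ω → ℕ) {m n : ℕ} (hm : 1 ≤ m)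
    (hn : 1 ≤ n) (ω : Ω) : lastPassage w m n ω = passageTime (fun v => w v ω) m n := by
  obtain ⟨m, rfl⟩ : ∃ k, m = k + 1 := ⟨m - 1, by omega⟩
  obtain ⟨n, rfl⟩ : ∃ k, n = k + 1 := ⟨n - 1, by omega⟩
  refine IsGreatest.csSup_eq ⟨?_, ?_⟩
  · obtain ⟨p, hp, hs⟩ := exists_isUpRightPath_sum_eq (fun v => w v ω) m n
    exact ⟨p, hp, hs.symm⟩
  · rintro s ⟨p, hp, rfl⟩
    exact hp.sum_le

/-! ### The law of the last passage time -/

theorem normalized_schurCDF_succ_le {m n : ℕ} (hmn : m ≤ n) {x : ℝ≥0} (hx0 : x ≠ 0) (hx1 : x < 1)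
    (t : ℕ) : (1 - x : ℝ≥0∞) ^ ((m + 1) * n) * schurCDF x (m + 1) n t ≤
      (1 - x : ℝ≥0∞) ^ (m * (n + 1)) * schurCDF x m (n + 1) t := by
  have h := schurCDF_succ_le hmn hx0 t
  rw [geomSum, ENNReal.tsum_geometric] at h
  have hy0 : (1 - x : ℝ≥0∞) ≠ 0 := by
    simpa [tsub_eq_zero_iff_le] using hx1
  have hy1 : (1 - x : ℝ≥0∞) ≠ ⊤ := by simp
  generalize (1 - x : ℝ≥0∞) = y at *
  have e (k : ℕ) : y ^ k * y⁻¹ ^ k = 1 := by rw [← mul_pow, ENNReal.mul_inv_cancel hy0 hy1, one_pow]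
  calc y ^ ((m + 1) * n) * schurCDF x (m + 1) n t
      = y ^ (m * n) * (y ^ n * (y ^ m * y⁻¹ ^ m) * schurCDF x (m + 1) n t) := by
        rw [e]; ring
    _ = y ^ (m * n) * y ^ n * y ^ m * (y⁻¹ ^ m * schurCDF x (m + 1) n t) := by ring
    _ ≤ y ^ (m * n) * y ^ n * y ^ m * (y⁻¹ ^ n * schurCDF x m (n + 1) t) := by gcongr
    _ = y ^ (m * n) * (y ^ m * (y ^ n * y⁻¹ ^ n) * schurCDF x m (n + 1) t) := by ring
    _ = _ := by rw [e]; ring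

theorem numChains_zero_right (n : ℕ) : numChains n 0 = 1 := by
  induction n with
  | zero => simp [numChains]
  | succ n ih =>
    have h : interlacingBelow 0 = {0} := by
      ext a
      rw [mem_interlacingBelow, Finset.mem_singleton]
      exact ⟨fun h => le_antisymm h.le zero_le, by rintro rfl i; simp⟩
    rw [numChains_succ, h, Finset.sum_singleton, ih]

/-- The Cauchy identity at `(1, …, 1)` and `(x, …, x)`. -/
theorem tsum_numChains_mul_numChains (x : ℝ≥0∞) (m n : ℕ) :
    ∑' μ : ℕ →₀ ℕ, (numChains m μ : ℝ≥0∞) * (numChains n μ * x ^ μ.degree) =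
      geomSum x ^ (m * n) := by
  induction m with
  | zero =>
    rw [tsum_eq_single 0 fun b hb => by simp [numChains, hb]]
    simp [numChains_zero_right]
  | succ m ih =>
    simp only [numChains_succ_tsum, ← ENNReal.tsum_mul_right]
    rw [tsum_comm_subtype (fun μ ν => Interlaces ν μ) fun μ ν =>
      (numChains m ν : ℝ≥0∞) * (numChains n μ * x ^ μ.degree)]
    simp only [ENNReal.tsum_mul_left, tsum_interlaces_numChains]
    simp only [mul_left_comm _ (geomSum x ^ n), ENNReal.tsum_mul_left, ih]
    ring

theorem geometricLaw_singleton (q : ℝ) (hq0 : 0 < q) (hq1 : q < 1) (k : ℕ) :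
    geometricLaw q hq0 hq1 {k} = (1 - ENNReal.ofReal q) * ENNReal.ofReal q ^ k := by
  rw [geometricLaw, geometricMeasure_singleton]
  · simp only [sub_sub_cancel]
    rw [ENNReal.ofReal_mul (by positivity), ENNReal.ofReal_pow hq0.le,
      ENNReal.ofReal_sub _ hq0.le, ENNReal.ofReal_one, mul_comm]
  · intro h
    have := congrArg Subtype.val h
    simp only [Set.Icc.coe_zero] at this
    linarith

section LastPassage

theorem lastPassage_eq_comp {Ω : Type*} (w : ℕ × ℕ → Ω → ℕ) {m n : ℕ} (hm : 1 ≤ m) (hn : 1 ≤ n) :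
    lastPassage w m n = (fun W : Fin n × Fin m → ℕ =>
      chainTop m (growthColumns m n (Function.curry W)) 0) ∘
        fun ω p => w (p.2 + 1, p.1 + 1) ω := by
  ext ω
  rw [lastPassage_eq_passageTime w hm hn, Function.comp_apply,
    ← chainTop_growthColumns_apply_zero]
  rfl

variable {Ω : Type*} [MeasurableSpace Ω] {P : Measure Ω} {w : ℕ × ℕ → Ω → ℕ} {q : ℝ} {hq0 : 0 < q}
  {hq1 : q < 1}

theorem aemeasurable_weights (hlaw : ∀ v, HasLaw (w v) (geometricLaw q hq0 hq1) P) (m n : ℕ) :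
    AEMeasurable (fun ω (p : Fin n × Fin m) => w (p.2 + 1, p.1 + 1) ω) P :=
  aemeasurable_pi_lambda _ fun _ => (hlaw _).aemeasurable

theorem aemeasurable_lastPassage (hlaw : ∀ v, HasLaw (w v) (geometricLaw q hq0 hq1) P)
    {m n : ℕ} (hm : 1 ≤ m) (hn : 1 ≤ n) : AEMeasurable (lastPassage w m n) P := by
  rw [lastPassage_eq_comp w hm hn]
  exact Measurable.of_discrete.comp_aemeasurable (aemeasurable_weights hlaw m n)

theorem map_weights_singleton (hind : iIndepFun w P)
    (hlaw : ∀ v, HasLaw (w v) (geometricLaw q hq0 hq1) P) (m n : ℕ) (W : Fin n × Fin m → ℕ) :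
    P.map (fun ω (p : Fin n × Fin m) => w (p.2 + 1, p.1 + 1) ω) {W} =
      (1 - ENNReal.ofReal q) ^ (m * n) * ENNReal.ofReal q ^ (∑ j, ∑ i, W (j, i)) := by
  have hinj : Function.Injective fun p : Fin n × Fin m => ((p.2 + 1, p.1 + 1) : ℕ × ℕ) := by
    rintro ⟨a, b⟩ ⟨c, d⟩ h
    simp only [Prod.mk.injEq, add_left_inj, Fin.val_inj] at h
    rw [h.1, h.2]
  rw [(hind.precomp hinj).map_fun_eq_pi_map fun p => (hlaw _).aemeasurable]
  simp only [(hlaw _).map_eq]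
  have : IsProbabilityMeasure (geometricLaw q hq0 hq1) := by
    unfold geometricLaw; infer_instance
  rw [Measure.pi_singleton]
  simp only [geometricLaw_singleton, Finset.prod_mul_distrib, Finset.prod_const,
    Finset.prod_pow_eq_pow_sum, Fintype.sum_prod_type, Finset.card_univ, Fintype.card_prod,
    Fintype.card_fin]
  rw [mul_comm n m]

theorem map_lastPassage_Iic (hind : iIndepFun w P)
    (hlaw : ∀ v, HasLaw (w v) (geometricLaw q hq0 hq1) P) {m n : ℕ} (hm : 1 ≤ m) (hn : 1 ≤ n)
    (t : ℕ) : P.map (lastPassage w m n) (Set.Iic t) =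
      (1 - ENNReal.ofReal q) ^ (m * n) * schurCDF (ENNReal.ofReal q) m n t := by
  classical
  rw [lastPassage_eq_comp w hm hn, ← AEMeasurable.map_map_of_aemeasurable
    Measurable.of_discrete.aemeasurable (aemeasurable_weights hlaw m n),
    Measure.map_apply Measurable.of_discrete measurableSet_Iic,
    ← Measure.tsum_indicator_apply_singleton _ _ (MeasurableSet.of_discrete)]
  simp only [map_weights_singleton hind hlaw]
  have h := tsum_chainTop_growthColumns (ENNReal.ofReal q) m n fun μ => if μ 0 ≤ t then 1 else 0
  rw [← (Equiv.curry (Fin n) (Fin m) ℕ).tsum_eq] at h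
  calc _ = (1 - ENNReal.ofReal q) ^ (m * n) * _ := by
        rw [← ENNReal.tsum_mul_left]
        refine tsum_congr fun W => ?_
        rw [Set.indicator_apply, ← mul_ite_zero]
    _ = _ := by
      congr 1
      refine Eq.trans ?_ (h.trans (Eq.trans ?_ (tsum_subtype {μ : ℕ →₀ ℕ | μ 0 ≤ t} fun μ =>
        (numChains m μ : ℝ≥0∞) * (numChains n μ * ENNReal.ofReal q ^ μ.degree)).symm))
      · refine tsum_congr fun W => ?_
        rw [mul_ite, mul_one, mul_zero]
        exact if_congr Iff.rfl rfl rfl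
      · refine tsum_congr fun μ => ?_
        by_cases h : μ 0 ≤ t <;> simp [h]

end LastPassage

theorem stochDom_of_Iic_le {μ ν : Measure ℕ} [IsProbabilityMeasure μ] [IsProbabilityMeasure ν]
    (h : ∀ t, ν (Set.Iic t) ≤ μ (Set.Iic t)) : StochDom μ ν := by
  intro A _ hA
  rcases hA.eq_empty_or_Ici with rfl | ⟨_ | t, rfl⟩
  · simp
  · have e : Set.Ici 0 = (Set.univ : Set ℕ) := by ext; simp
    rw [e, measure_univ, measure_univ]
  · have e : Set.Ici (t + 1) = (Set.Iic t)ᶜ := by ext; simp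
    rw [e, prob_compl_eq_one_sub measurableSet_Iic, prob_compl_eq_one_sub measurableSet_Iic]
    exact tsub_le_tsub_left (h t) 1

theorem stochDom_lastPassage {Ω : Type*} [MeasurableSpace Ω] {P : Measure Ω}
    [IsProbabilityMeasure P] {w : ℕ × ℕ → Ω → ℕ} {q : ℝ} {hq0 : 0 < q} {hq1 : q < 1}
    (hind : iIndepFun w P) (hlaw : ∀ v, HasLaw (w v) (geometricLaw q hq0 hq1) P) {m n : ℕ}
    (hm : 1 ≤ m) (hmn : m ≤ n) :
    StochDom (P.map (lastPassage w m (n + 1))) (P.map (lastPassage w (m + 1) n)) := by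
  have h1 : AEMeasurable (lastPassage w m (n + 1)) P :=
    aemeasurable_lastPassage hlaw hm (by omega)
  have h2 : AEMeasurable (lastPassage w (m + 1) n) P :=
    aemeasurable_lastPassage hlaw (by omega) (by omega)
  have := Measure.isProbabilityMeasure_map h1
  have := Measure.isProbabilityMeasure_map h2
  refine stochDom_of_Iic_le fun t => ?_
  rw [map_lastPassage_Iic hind hlaw (by omega) (by omega),
    map_lastPassage_Iic hind hlaw (by omega) (by omega)]
  exact normalized_schurCDF_succ_le hmn (x := q.toNNReal) (by simpa using hq0)
    (by simpa using hq1) t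

/-! ### The determinantal formula for the number of chains -/

theorem numChains_ne_zero {k : ℕ} {a : ℕ →₀ ℕ} (h : numChains k a ≠ 0) :
    Antitone a ∧ a k = 0 := by
  induction k generalizing a with
  | zero =>
    have : a = 0 := by by_contra h'; simp [numChains, h'] at h
    subst this
    exact ⟨fun _ _ _ => le_rfl, rfl⟩
  | succ k ih =>
    obtain ⟨c, hc, hk⟩ := Finset.exists_ne_zero_of_sum_ne_zero h
    rw [mem_interlacingBelow] at hc
    refine ⟨antitone_nat_of_succ_le fun i => (hc i).1.trans (hc i).2, ?_⟩
    have := (hc k).1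
    have := (ih hk).2
    omega

/-- The particle configuration `(a 0 + k - 1, …, a (k - 1))` of a sequence `a`. -/
def particles (k : ℕ) (a : ℕ →₀ ℕ) (i : Fin k) : ℕ := a i + (k - 1 - i)

/-- The determinant of the binomial coefficients `binom (x i) (k - 1 - j)`. -/
def binomDet (k : ℕ) (x : Fin k → ℕ) : ℤ :=
  (Matrix.of fun i j : Fin k => ((x i).choose (k - 1 - j) : ℤ)).det

theorem sum_Ico_choose_eq_sub {m n : ℕ} (h : m ≤ n) (k : ℕ) :
    ∑ x ∈ Finset.Ico m n, (x.choose k : ℤ) = n.choose (k + 1) - m.choose (k + 1) := by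
  rw [Finset.sum_Ico_eq_sub _ h]
  have key (n : ℕ) : ∑ x ∈ Finset.range n, (x.choose k : ℤ) = n.choose (k + 1) := by
    induction n with
    | zero => simp
    | succ n ih => rw [Finset.sum_range_succ, ih, Nat.choose_succ_succ]; push_cast; ring
  rw [key, key]

theorem binomDet_succ (k : ℕ) {y : Fin (k + 1) → ℕ} (hy : ∀ i : Fin k, y i.succ ≤ y i.castSucc) :
    binomDet (k + 1) y =
      ∑ x ∈ Fintype.piFinset fun i : Fin k => Finset.Ico (y i.succ) (y i.castSucc),
        binomDet k x := by
  set A : Matrix (Fin (k + 1)) (Fin (k + 1)) ℤ :=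
    Matrix.of fun i j => ((y i).choose (k + 1 - 1 - j) : ℤ) with hA
  set B : Matrix (Fin (k + 1)) (Fin (k + 1)) ℤ :=
    Matrix.of (Fin.cons (A 0) fun i j => A i.succ j - A i.castSucc j) with hB
  set D : Matrix (Fin k) (Fin k) ℤ :=
    Matrix.of fun i j => ∑ x ∈ Finset.Ico (y i.succ) (y i.castSucc), (x.choose (k - 1 - j) : ℤ)
    with hD
  have hAB : A.det = B.det := Matrix.det_eq_of_forall_row_eq_smul_add_pred (fun _ => 1)
    (fun j => rfl) fun i j => by simp [hB]
  have hlast (i : Fin k) : B i.succ (Fin.last k) = 0 := by simp [hB, hA]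
  have hzero : B 0 (Fin.last k) = 1 := by simp [hB, hA]
  have hsub : B.submatrix Fin.succ Fin.castSucc = -D := by
    ext i j
    have hj : k - j = k - 1 - j + 1 := by have := j.2; omega
    simp only [hB, hD, hA, Matrix.submatrix_apply, Matrix.of_apply, Fin.cons_succ,
      Matrix.neg_apply, sum_Ico_choose_eq_sub (hy i), Fin.val_castSucc, Nat.add_sub_cancel, hj]
    ring
  have hBD : B.det = D.det := by
    rw [Matrix.det_succ_column B (Fin.last k), Fin.sum_univ_succ,
      Finset.sum_eq_zero fun i _ => by rw [hlast]; ring, hzero]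
    simp only [Fin.succAbove_last, Fin.val_zero, Fin.val_last]
    have hsub' : B.submatrix (Fin.succAbove 0) Fin.castSucc = -D := hsub
    rw [hsub', Matrix.det_neg, Fintype.card_fin, zero_add, add_zero, mul_one, ← mul_assoc,
      ← mul_pow]
    simp
  change A.det = _
  rw [hAB, hBD]
  have h := MultilinearMap.map_sum_finset
    (Matrix.detRowAlternating (n := Fin k) (R := ℤ)).toMultilinearMap
    (fun (_ : Fin k) (x : ℕ) (j : Fin k) => (x.choose (k - 1 - j) : ℤ))
    fun i => Finset.Ico (y i.succ) (y i.castSucc)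
  refine Eq.trans ?_ h
  congr 1
  ext i j
  simp [hD, Finset.sum_apply]

theorem numChains_eq_binomDet {k : ℕ} {a : ℕ →₀ ℕ} (ha : Antitone a) (hk : a k = 0) :
    (numChains k a : ℤ) = binomDet k (particles k a) := by
  induction k generalizing a with
  | zero =>
    have : a = 0 := by ext i; have := ha (Nat.zero_le i); simp; omega
    simp [this, numChains, binomDet]
  | succ k ih =>
    rw [binomDet_succ, numChains_succ, Nat.cast_sum,
      ← Finset.sum_filter_of_ne (p := fun c => c k = 0)]
    · refine Finset.sum_bij' (fun c _ => particles k c)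
        (fun x _ => Finsupp.onFinset (Finset.range k)
          (fun i => if h : i < k then x ⟨i, h⟩ - (k - 1 - i) else 0) ?_) ?_ ?_ ?_ ?_ ?_
      · intro i hi
        by_contra h
        exact hi (dif_neg (by simpa using h))
      · intro c hc
        simp only [Finset.mem_filter, mem_interlacingBelow] at hc
        simp only [Fintype.mem_piFinset, Finset.mem_Ico, particles, Fin.val_succ,
          Fin.val_castSucc]
        intro i
        have := hc.1 i
        have := i.2
        omega
      · intro x hx
        simp only [Fintype.mem_piFinset, Finset.mem_Ico, particles, Fin.val_succ,
          Fin.val_castSucc] at hx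
        simp only [Finset.mem_filter, mem_interlacingBelow, Finsupp.onFinset_apply,
          lt_irrefl, dite_false, and_true]
        intro i
        simp only [Finsupp.onFinset_apply]
        split_ifs with h
        · have := hx ⟨i, h⟩
          simp only at this
          omega
        · have := ha (show k + 1 ≤ i + 1 by omega)
          omega
      · intro c hc
        simp only [Finset.mem_filter, mem_interlacingBelow] at hc
        ext i
        simp only [Finsupp.onFinset_apply, particles]
        split_ifs with h
        · omega
        · have h1 := (hc.1 i).2
          rcases eq_or_lt_of_le (not_lt.1 h) with rfl | h2
          · exact hc.2.symm
          · have := ha (show k + 1 ≤ i by omega)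
            omega
      · intro x hx
        simp only [Fintype.mem_piFinset, Finset.mem_Ico, particles, Fin.val_succ,
          Fin.val_castSucc] at hx
        ext i
        have := hx i
        have := i.2
        simp only [particles, Finsupp.onFinset_apply, Fin.is_lt, dite_true, Fin.eta]
        omega
      · intro c hc
        simp only [Finset.mem_filter, mem_interlacingBelow] at hc
        exact ih (antitone_nat_of_succ_le fun i => (hc.1 (i + 1)).2.trans (hc.1 i).1) hc.2
    · intro c _ hc
      exact (numChains_ne_zero (by exact_mod_cast hc)).2
    · intro i
      have := ha (Nat.le_add_right (i : ℕ) 1)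
      have := i.2
      simp only [particles, Fin.val_succ, Fin.val_castSucc]
      omega

/-- The absolute value of the Vandermonde determinant. -/
def absVandermonde (k : ℕ) (x : Fin k → ℕ) : ℝ :=
  ∏ i : Fin k, ∏ j ∈ Finset.Ioi i, |(x j : ℝ) - x i|

theorem abs_binomDet_mul (k : ℕ) (x : Fin k → ℕ) :
    (∏ i : Fin k, ((i : ℕ).factorial : ℝ)) * |(binomDet k x : ℝ)| = absVandermonde k x := by
  have h1 : |binomDet k x| = |(Matrix.of fun i j : Fin k => ((x i).choose j : ℤ)).det| := by
    rw [← Matrix.abs_det_submatrix_equiv_equiv (Equiv.refl _) Fin.revPerm]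
    refine congrArg (fun M : Matrix (Fin k) (Fin k) ℤ => |M.det|) ?_
    ext i j
    simp only [Matrix.submatrix_apply, Matrix.of_apply, Equiv.refl_apply, Fin.revPerm_apply,
      Fin.val_rev]
    congr 2
    omega
  have h2 := Matrix.det_eval_matrixOfPolynomials_eq_det_vandermonde (fun i => (x i : ℤ))
    (fun i => descPochhammer ℤ i) (fun i => descPochhammer_natDegree ℤ i)
    (fun i => monic_descPochhammer ℤ i)
  have h3 : (Matrix.of fun i j : Fin k => (descPochhammer ℤ j).eval (x i : ℤ)).det =
      (∏ i : Fin k, ((i : ℕ).factorial : ℤ)) *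
        (Matrix.of fun i j : Fin k => ((x i).choose j : ℤ)).det := by
    rw [← Matrix.det_mul_row]
    congr 1
    ext i j
    rw [Matrix.of_apply, Matrix.of_apply, descPochhammer_eval_eq_descFactorial,
      Nat.descFactorial_eq_factorial_mul_choose]
    push_cast
    rfl
  have h4 : (∏ i : Fin k, ((i : ℕ).factorial : ℤ)) * |binomDet k x| =
      |(Matrix.vandermonde fun i => (x i : ℤ)).det| := by
    rw [h1, h2, h3, abs_mul, abs_of_nonneg (a := ∏ i : Fin k, ((i : ℕ).factorial : ℤ))
      (Finset.prod_nonneg fun i _ => by positivity)]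
  rw [Matrix.det_vandermonde] at h4
  have h5 := congrArg (Int.cast : ℤ → ℝ) h4
  push_cast at h5
  rw [h5, absVandermonde, Finset.abs_prod]
  exact Finset.prod_congr rfl fun i _ => Finset.abs_prod _ _

theorem numChains_mul_prod_factorial {k : ℕ} {a : ℕ →₀ ℕ} (ha : Antitone a) (hk : a k = 0) :
    (∏ i : Fin k, ((i : ℕ).factorial : ℝ)) * (numChains k a : ℝ) =
      absVandermonde k (particles k a) := by
  rw [← abs_binomDet_mul, ← numChains_eq_binomDet ha hk]
  simp

theorem absVandermonde_succ (k : ℕ) (x : Fin (k + 1) → ℕ) :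
    absVandermonde (k + 1) x = absVandermonde k (fun i => x i.castSucc) *
      ∏ i : Fin k, |(x (Fin.last k) : ℝ) - x i.castSucc| := by
  have e (k : ℕ) (x : Fin k → ℕ) : absVandermonde k x =
      ∏ i : Fin k, ∏ j : Fin k, if i < j then |(x j : ℝ) - x i| else 1 := by
    refine Finset.prod_congr rfl fun i _ => ?_
    rw [← Finset.prod_filter]
    refine Finset.prod_congr ?_ fun _ _ => rfl
    ext; simp
  simp [e, Fin.prod_univ_castSucc, Finset.prod_mul_distrib, Fin.castSucc_lt_last,
    (Fin.castSucc_lt_last _).not_gt]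

theorem absVandermonde_particles_succ {n : ℕ} {a : ℕ →₀ ℕ} (h : a n = 0) :
    absVandermonde (n + 1) (particles (n + 1) a) = absVandermonde n (particles n a) *
      ∏ i ∈ Finset.range n, ((a i + (n - i) : ℕ) : ℝ) := by
  rw [absVandermonde_succ, ← Fin.prod_univ_eq_prod_range fun i => ((a i + (n - i) : ℕ) : ℝ)]
  have hp (i : Fin n) : particles (n + 1) a i.castSucc = particles n a i + 1 := by
    have := i.2
    simp only [particles, Fin.val_castSucc]; omega
  congr 1
  · simp [absVandermonde, hp]
  · refine Finset.prod_congr rfl fun i _ => ?_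
    have h0 : particles (n + 1) a (Fin.last n) = 0 := by simp [particles, h]
    rw [h0, Nat.cast_zero, zero_sub, abs_neg, abs_of_nonneg (by positivity)]
    simp [particles]

/-- The number of chains of length `n` with few parts, in terms of the number of shorter chains. -/
theorem exists_numChains_eq_mul_prod_choose {m n : ℕ} (hmn : m ≤ n) :
    ∃ c : ℝ, 0 < c ∧ ∀ a : ℕ →₀ ℕ, Antitone a → a m = 0 → (numChains n a : ℝ) =
      c * (numChains m a * ∏ i : Fin m,
        ((particles m a i + (n - m)).choose (particles m a i) : ℝ)) := by
  induction n, hmn using Nat.le_induction with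
  | base => exact ⟨1, one_pos, fun a _ _ => by simp⟩
  | succ n hmn ih =>
    obtain ⟨c, hc, H⟩ := ih
    set E : ℝ := ∏ i ∈ Finset.Ico m n, ((n - i : ℕ) : ℝ) with hE
    have hE0 : 0 < E := Finset.prod_pos fun i hi => by
      have := (Finset.mem_Ico.1 hi).2
      exact_mod_cast (by omega : 0 < n - i)
    set f : ℕ → ℝ := fun k => ∏ i : Fin k, ((i : ℕ).factorial : ℝ) with hf
    have hf0 (k : ℕ) : 0 < f k := Finset.prod_pos fun i _ => by positivity
    refine ⟨c * f n / f (n + 1) * E * ((n - m + 1 : ℕ) : ℝ) ^ m, ?_, fun a ha hm => ?_⟩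
    · have := hf0 n
      have := hf0 (n + 1)
      positivity
    · have hz (i : ℕ) (hi : m ≤ i) : a i = 0 := by have := ha hi; omega
      have h1 := numChains_mul_prod_factorial (k := n + 1) ha (hz _ (by omega))
      rw [absVandermonde_particles_succ (hz n hmn),
        ← numChains_mul_prod_factorial ha (hz n hmn), H a ha hm] at h1
      have h2 : ∏ i ∈ Finset.range n, ((a i + (n - i) : ℕ) : ℝ) =
          (∏ i : Fin m, ((particles m a i + (n - m) + 1 : ℕ) : ℝ)) * E := by
        rw [← Finset.prod_range_mul_prod_Ico _ hmn, hE,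
          ← Fin.prod_univ_eq_prod_range fun i => ((a i + (n - i) : ℕ) : ℝ)]
        congr 1
        · refine Finset.prod_congr rfl fun i _ => ?_
          have := i.2
          congr 1
          simp only [particles]; omega
        · refine Finset.prod_congr rfl fun i hi => ?_
          rw [hz i (Finset.mem_Ico.1 hi).1, zero_add]
      have h3 : (∏ i : Fin m, ((particles m a i + (n - m)).choose (particles m a i) : ℝ)) *
          (∏ i : Fin m, ((particles m a i + (n - m) + 1 : ℕ) : ℝ)) =
          (∏ i : Fin m, ((particles m a i + (n + 1 - m)).choose (particles m a i) : ℝ)) *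
            ((n - m + 1 : ℕ) : ℝ) ^ m := by
        have e : ((n - m + 1 : ℕ) : ℝ) ^ m = ∏ i : Fin m, ((n - m + 1 : ℕ) : ℝ) := by simp
        rw [e, ← Finset.prod_mul_distrib, ← Finset.prod_mul_distrib]
        refine Finset.prod_congr rfl fun i _ => ?_
        have h4 := Nat.choose_mul_succ_eq (particles m a i + (n - m)) (particles m a i)
        rw [show particles m a i + (n - m) + 1 - particles m a i = n - m + 1 by omega] at h4
        rw [show particles m a i + (n + 1 - m) = particles m a i + (n - m) + 1 by omega]
        exact_mod_cast h4
      have h5 := hf0 (n + 1)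
      rw [h2] at h1
      change f (n + 1) * _ = f n * _ * _ at h1
      rw [← mul_right_inj' h5.ne', h1]
      field_simp
      linear_combination f n * (numChains m a : ℝ) * h3

/-! ### The law of the rightmost particle of the Meixner ensemble -/

theorem prod_prod_Ioi_sub_sq_eq (m : ℕ) (h : Fin m → ℕ) :
    ∏ i : Fin m, ∏ j ∈ Finset.Ioi i, ((h i : ℝ) - h j) ^ 2 =
      |(Matrix.vandermonde fun i => (h i : ℝ)).det| ^ 2 := by
  rw [sq_abs, Matrix.det_vandermonde, ← Finset.prod_pow]
  refine Finset.prod_congr rfl fun i _ => ?_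
  rw [← Finset.prod_pow]
  exact Finset.prod_congr rfl fun j _ => by ring

theorem meixnerWeight_comp_perm (q : ℝ) (m n : ℕ) (h : Fin m → ℕ) (σ : Equiv.Perm (Fin m)) :
    meixnerWeight q m n (h ∘ σ) = meixnerWeight q m n h := by
  unfold meixnerWeight
  rw [prod_prod_Ioi_sub_sq_eq, prod_prod_Ioi_sub_sq_eq,
    ← Matrix.abs_det_submatrix_equiv_equiv σ (Equiv.refl _)
      (Matrix.vandermonde fun i => (h i : ℝ))]
  refine congrArg₂ (· * ·) rfl ?_
  exact Equiv.prod_comp σ fun i => (((h i + (n - m)).choose (h i) : ℕ) : ℝ) * q ^ h i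

theorem meixnerWeight_eq_zero (q : ℝ) (m n : ℕ) {h : Fin m → ℕ} (hh : ¬ Function.Injective h) :
    meixnerWeight q m n h = 0 := by
  have h0 : (Matrix.vandermonde fun i => (h i : ℝ)).det = 0 := by
    by_contra H
    exact hh fun i j hij => Matrix.det_vandermonde_ne_zero_iff.1 H (by simp [hij])
  unfold meixnerWeight
  rw [prod_prod_Ioi_sub_sq_eq, h0]
  simp

theorem rightmost_comp_perm {m : ℕ} (h : Fin m → ℕ) (σ : Equiv.Perm (Fin m)) :
    rightmost (h ∘ σ) = rightmost h := by
  refine le_antisymm (Finset.sup_le fun i _ => ?_) (Finset.sup_le fun i _ => ?_)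
  · exact Finset.le_sup (f := h) (Finset.mem_univ (σ i))
  · simpa [rightmost] using Finset.le_sup (f := h ∘ σ) (Finset.mem_univ (σ.symm i))

theorem existsUnique_strictAnti_comp_perm {m : ℕ} {h : Fin m → ℕ} (hh : Function.Injective h) :
    ∃! σ : Equiv.Perm (Fin m), StrictAnti (h ∘ σ) := by
  refine ⟨Tuple.sort (OrderDual.toDual ∘ h), ?_, fun σ hσ => ?_⟩
  · have h1 : Antitone (h ∘ Tuple.sort (OrderDual.toDual ∘ h)) :=
      fun i j hij => Tuple.monotone_sort (OrderDual.toDual ∘ h) hij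
    exact h1.strictAnti_of_injective (hh.comp (Equiv.injective _))
  · have h1 : Antitone (h ∘ Tuple.sort (OrderDual.toDual ∘ h)) :=
      fun i j hij => Tuple.monotone_sort (OrderDual.toDual ∘ h) hij
    have h2 := Tuple.unique_antitone hσ.antitone h1
    ext i
    exact congrArg Fin.val (hh (congrFun h2 i))

/-- Summing a symmetric function that vanishes off the injective configurations. -/
theorem tsum_eq_factorial_mul_tsum_strictAnti {m : ℕ} (F : (Fin m → ℕ) → ℝ≥0∞)
    (hperm : ∀ h (σ : Equiv.Perm (Fin m)), F (h ∘ σ) = F h)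
    (hzero : ∀ h, ¬ Function.Injective h → F h = 0) :
    ∑' h, F h = m.factorial * ∑' h : {h : Fin m → ℕ // StrictAnti h}, F h := by
  classical
  have h1 (h : Fin m → ℕ) : F h =
      ∑' σ : Equiv.Perm (Fin m), {h : Fin m → ℕ | StrictAnti h}.indicator F (h ∘ σ) := by
    by_cases hh : Function.Injective h
    · obtain ⟨σ, hσ, hu⟩ := existsUnique_strictAnti_comp_perm hh
      rw [tsum_eq_single σ, Set.indicator_of_mem (by exact hσ), hperm]
      exact fun τ hτ => Set.indicator_of_notMem (fun H => hτ (hu τ H)) _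
    · simp [Set.indicator_apply, hperm, hzero h hh]
  calc ∑' h, F h = ∑' (h : Fin m → ℕ) (σ : Equiv.Perm (Fin m)),
        {h : Fin m → ℕ | StrictAnti h}.indicator F (h ∘ σ) := tsum_congr h1
    _ = ∑' (σ : Equiv.Perm (Fin m)) (h : Fin m → ℕ),
        {h : Fin m → ℕ | StrictAnti h}.indicator F (h ∘ σ) := ENNReal.tsum_comm
    _ = ∑' _ : Equiv.Perm (Fin m), ∑' h : {h : Fin m → ℕ // StrictAnti h}, F h := by
        refine tsum_congr fun σ => ?_
        refine Eq.trans ?_ (tsum_subtype {h : Fin m → ℕ | StrictAnti h} F).symm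
        exact (σ.symm.arrowCongr (Equiv.refl ℕ)).tsum_eq
          ({h : Fin m → ℕ | StrictAnti h}.indicator F)
    _ = _ := by
        rw [tsum_fintype, Finset.sum_const, Finset.card_univ, Fintype.card_perm, Fintype.card_fin,
          nsmul_eq_mul]

theorem StrictAnti.add_le_of_add_lt {m : ℕ} {h : Fin m → ℕ} (hh : StrictAnti h) (i d : ℕ)
    (hid : i + d < m) : h ⟨i + d, hid⟩ + d ≤ h ⟨i, by omega⟩ := by
  induction d with
  | zero => simp
  | succ d ih =>
    have h1 := ih (by omega)
    have h2 : h ⟨i + (d + 1), hid⟩ < h ⟨i + d, by omega⟩ := hh (by simp)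
    omega

theorem StrictAnti.sub_le {m : ℕ} {h : Fin m → ℕ} (hh : StrictAnti h) (i : Fin m) :
    m - 1 - i ≤ h i := by
  have := i.2
  have := hh.add_le_of_add_lt i (m - 1 - i) (by omega)
  exact le_trans (by omega) this

/-- Partitions with at most `m` parts are the same as configurations of `m` ordered particles. -/
noncomputable def particlesEquiv (m : ℕ) :
    {a : ℕ →₀ ℕ // Antitone a ∧ a m = 0} ≃ {h : Fin m → ℕ // StrictAnti h} where
  toFun a := ⟨particles m a, fun i j hij => by
    have h1 := a.2.1 (show (i : ℕ) ≤ j from hij.le)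
    have h2 : (i : ℕ) < j := hij
    have := j.2
    simp only [particles]
    omega⟩
  invFun h := ⟨Finsupp.onFinset (Finset.range m)
      (fun i => if hi : i < m then h.1 ⟨i, hi⟩ - (m - 1 - i) else 0) (fun i hi => by
        by_contra H
        exact hi (dif_neg (by simpa using H))), by
    refine ⟨fun i j hij => ?_, by simp⟩
    simp only [Finsupp.onFinset_apply]
    split_ifs with h1 h2
    · obtain ⟨d, rfl⟩ := Nat.exists_eq_add_of_le hij
      have := h.2.add_le_of_add_lt i d h1
      omega
    · omega
    · exact Nat.zero_le _
    · exact le_rfl⟩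
  left_inv := by
    rintro ⟨a, ha, hm⟩
    ext i
    simp only [particles, Finsupp.onFinset_apply]
    split_ifs with hi
    · omega
    · have := ha (not_lt.1 hi)
      omega
  right_inv := by
    rintro ⟨h, hh⟩
    ext i
    have := hh.sub_le i
    simp only [particles, Finsupp.onFinset_apply, Fin.is_lt, dite_true, Fin.eta]
    omega

theorem rightmost_particles_le_iff {m : ℕ} (hm : 1 ≤ m) {a : ℕ →₀ ℕ} (ha : Antitone a) (s : ℕ) :
    rightmost (particles m a) ≤ s ↔ a 0 + (m - 1) ≤ s := by
  rw [rightmost, Finset.sup_le_iff]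
  refine ⟨fun h => by simpa [particles] using h ⟨0, hm⟩ (Finset.mem_univ _), fun h i _ => ?_⟩
  have := ha (Nat.zero_le i)
  simp only [particles]
  omega

theorem exists_meixnerWeight_particles {q : ℝ} (hq0 : 0 < q) {m n : ℕ} (hmn : m ≤ n) :
    ∃ c : ℝ, 0 < c ∧ ∀ a : ℕ →₀ ℕ, Antitone a → a m = 0 →
      meixnerWeight q m n (particles m a) =
        c * (numChains m a * (numChains n a * q ^ a.degree)) := by
  obtain ⟨c, hc, H⟩ := exists_numChains_eq_mul_prod_choose hmn
  set f : ℝ := ∏ i : Fin m, ((i : ℕ).factorial : ℝ) with hf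
  have hf0 : 0 < f := Finset.prod_pos fun i _ => by positivity
  refine ⟨f ^ 2 * c⁻¹ * q ^ ∑ i : Fin m, (m - 1 - (i : ℕ)), by positivity, fun a ha hm => ?_⟩
  have h1 : ∏ i : Fin m, ∏ j ∈ Finset.Ioi i,
      ((particles m a i : ℝ) - particles m a j) ^ 2 = (f * numChains m a) ^ 2 := by
    rw [numChains_mul_prod_factorial ha hm, absVandermonde, ← Finset.prod_pow]
    refine Finset.prod_congr rfl fun i _ => ?_
    rw [← Finset.prod_pow]
    refine Finset.prod_congr rfl fun j _ => ?_
    rw [sq_abs]; ring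
  have h2 : a.degree = ∑ i : Fin m, a i := by
    rw [Fin.sum_univ_eq_sum_range a, Finsupp.degree_apply]
    refine Finset.sum_subset (fun i hi => ?_) fun i _ hi => Finsupp.notMem_support_iff.1 hi
    rw [Finset.mem_range]
    by_contra h
    have := ha (not_lt.1 h)
    rw [Finsupp.mem_support_iff] at hi
    omega
  have h3 : ∏ i : Fin m, q ^ particles m a i =
      q ^ a.degree * q ^ ∑ i : Fin m, (m - 1 - (i : ℕ)) := by
    rw [Finset.prod_pow_eq_pow_sum, h2, ← pow_add, ← Finset.sum_add_distrib]
    rfl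
  unfold meixnerWeight
  rw [h1, Finset.prod_mul_distrib, h3, H a ha hm]
  field_simp

theorem exists_tsum_meixnerWeight {q : ℝ} (hq0 : 0 < q) {m n : ℕ} (hmn : m ≤ n) :
    ∃ C : ℝ≥0∞, C ≠ 0 ∧ C ≠ ⊤ ∧ ∀ φ : (Fin m → ℕ) → ℝ≥0∞,
      (∀ h (σ : Equiv.Perm (Fin m)), φ (h ∘ σ) = φ h) →
      ∑' h, ENNReal.ofReal (meixnerWeight q m n h) * φ h =
        C * ∑' a : ℕ →₀ ℕ, (numChains m a : ℝ≥0∞) *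
          (numChains n a * ENNReal.ofReal q ^ a.degree) * φ (particles m a) := by
  obtain ⟨c, hc, H⟩ := exists_meixnerWeight_particles hq0 hmn
  refine ⟨m.factorial * ENNReal.ofReal c, ?_, ?_, fun φ hφ => ?_⟩
  · exact mul_ne_zero (by exact_mod_cast m.factorial_ne_zero) (by simpa using hc)
  · exact ENNReal.mul_ne_top (by simp) (by simp)
  · rw [tsum_eq_factorial_mul_tsum_strictAnti, mul_assoc]
    · congr 1
      rw [← ENNReal.tsum_mul_left, ← (particlesEquiv m).tsum_eq]
      refine Eq.trans (tsum_congr fun a => ?_) (tsum_subtype_eq_of_support_subset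
        (s := {a : ℕ →₀ ℕ | Antitone a ∧ a m = 0}) fun a ha => ?_)
      · change ENNReal.ofReal (meixnerWeight q m n (particles m a)) * φ (particles m a) = _
        rw [H a a.2.1 a.2.2, ENNReal.ofReal_mul hc.le, ENNReal.ofReal_mul (by positivity),
          ENNReal.ofReal_mul (by positivity), ENNReal.ofReal_natCast, ENNReal.ofReal_natCast,
          ENNReal.ofReal_pow hq0.le]
        ring
      · refine numChains_ne_zero fun h0 => ha ?_
        simp [h0]
    · intro h σ
      rw [meixnerWeight_comp_perm, hφ]
    · intro h hh
      rw [meixnerWeight_eq_zero q m n hh]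
      simp

theorem meixnerRightmostLaw_Iic (q : ℝ) (hq0 : 0 < q) (hq1 : q < 1) {m n : ℕ} (hm : 1 ≤ m)
    (hmn : m ≤ n) (s : ℕ) : meixnerRightmostLaw q hq0 hq1 m n (Set.Iic s) =
      if m - 1 ≤ s then (1 - ENNReal.ofReal q) ^ (m * n) *
        schurCDF (ENNReal.ofReal q) m n (s - (m - 1)) else 0 := by
  classical
  obtain ⟨C, hC0, hC1, H⟩ := exists_tsum_meixnerWeight hq0 hmn
  have hden : ∑' h, ENNReal.ofReal (meixnerWeight q m n h) =
      C * ((1 - ENNReal.ofReal q) ^ (m * n))⁻¹ := by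
    have h1 := H (fun _ => 1) fun _ _ => rfl
    simp only [mul_one] at h1
    rw [h1, tsum_numChains_mul_numChains, geomSum, ENNReal.tsum_geometric, ENNReal.inv_pow]
  have hnum : ∑' h, ENNReal.ofReal (meixnerWeight q m n h) *
      (if rightmost h ≤ s then 1 else 0) = C * if m - 1 ≤ s then
        schurCDF (ENNReal.ofReal q) m n (s - (m - 1)) else 0 := by
    rw [H (fun h => if rightmost h ≤ s then 1 else 0) fun h σ => by rw [rightmost_comp_perm]]
    congr 1
    have h1 (a : ℕ →₀ ℕ) : (numChains m a : ℝ≥0∞) *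
        (numChains n a * ENNReal.ofReal q ^ a.degree) *
          (if rightmost (particles m a) ≤ s then 1 else 0) =
        if a 0 + (m - 1) ≤ s then (numChains m a : ℝ≥0∞) *
          (numChains n a * ENNReal.ofReal q ^ a.degree) else 0 := by
      by_cases h0 : numChains m a = 0
      · simp [h0]
      · rw [mul_ite, mul_one, mul_zero]
        exact if_congr (rightmost_particles_le_iff hm (numChains_ne_zero h0).1 s) rfl rfl
    simp only [h1]
    split_ifs with hs
    · refine Eq.trans (tsum_congr fun a => ?_) (tsum_subtype {μ : ℕ →₀ ℕ | μ 0 ≤ s - (m - 1)}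
        fun μ => (numChains m μ : ℝ≥0∞) * (numChains n μ * ENNReal.ofReal q ^ μ.degree)).symm
      rw [Set.indicator_apply]
      refine if_congr ?_ rfl rfl
      rw [Set.mem_ofPred_eq]
      omega
    · rw [ENNReal.tsum_eq_zero]
      exact fun a => if_neg (by omega)
  rw [meixnerRightmostLaw, Measure.map_apply Measurable.of_discrete measurableSet_Iic,
    PMF.toMeasure_apply _ MeasurableSet.of_discrete]
  calc _ = (∑' h, ENNReal.ofReal (meixnerWeight q m n h) *
        (if rightmost h ≤ s then 1 else 0)) *
          (∑' h, ENNReal.ofReal (meixnerWeight q m n h))⁻¹ := by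
        rw [← ENNReal.tsum_mul_right]
        refine tsum_congr fun h => ?_
        rw [Set.indicator_apply, meixnerEnsemble, PMF.normalize_apply]
        by_cases hs : rightmost h ≤ s <;> simp [hs]
    _ = _ := by
        rw [hnum, hden, ← div_eq_mul_inv, ENNReal.mul_div_mul_left _ _ hC0 hC1, div_eq_mul_inv,
          inv_inv, mul_comm, mul_ite, mul_zero]

theorem stochDom_meixnerRightmostLaw (q : ℝ) (hq0 : 0 < q) (hq1 : q < 1) {m n : ℕ} (hm : 1 ≤ m)
    (hmn : m < n) : StochDom (meixnerRightmostLaw q hq0 hq1 m (n + 1))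
      (meixnerRightmostLaw q hq0 hq1 (m + 1) n) := by
  have inst (m n : ℕ) : IsProbabilityMeasure (meixnerRightmostLaw q hq0 hq1 m n) :=
    Measure.isProbabilityMeasure_map Measurable.of_discrete.aemeasurable
  refine stochDom_of_Iic_le fun s => ?_
  rw [meixnerRightmostLaw_Iic q hq0 hq1 hm (by omega),
    meixnerRightmostLaw_Iic q hq0 hq1 (by omega) hmn]
  split_ifs with h1 h2
  · refine (normalized_schurCDF_succ_le hmn.le (x := q.toNNReal) (by simpa using hq0)
      (by simpa using hq1) _).trans ?_
    exact mul_le_mul' le_rfl (schurCDF_mono _ _ _ (by omega))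
  · omega
  · exact zero_le
  · exact le_rfl

theorem mainTheorem4 (q : ℝ) (hq0 : 0 < q) (hq1 : q < 1) (n : ℕ) (hn : 2 ≤ n) :
    StochDom (meixnerRightmostLaw q hq0 hq1 (n - 1) (n + 1)) (meixnerRightmostLaw q hq0 hq1 n n) ∧
    ∀ {Ω : Type*} [MeasurableSpace Ω] (P : Measure Ω) [IsProbabilityMeasure P]
      (w : ℕ × ℕ → Ω → ℕ), iIndepFun w P → (∀ v, HasLaw (w v) (geometricLaw q hq0 hq1) P) →
      StochDom (P.map (lastPassage w (n - 1) (n + 1))) (P.map (lastPassage w n n)) := by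
  obtain ⟨m, rfl⟩ : ∃ m, n = m + 1 := ⟨n - 1, by omega⟩
  refine ⟨stochDom_meixnerRightmostLaw q hq0 hq1 (by omega) (by omega), ?_⟩
  intro Ω _ P _ w hind hlaw
  exact stochDom_lastPassage hind hlaw (by omega) (by omega)
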